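/- Setting. A finite set of DAG tasks $\tau_i$ shares finitely many resources $\ell_q$. Task $\tau_i$ has a minimum separation (period) $T_i$ between consecutive job releases, a relative deadline $0<D_i\le T_i$, and a finite acyclic precedence graph whose vertices $v$ have worst-case execution times $c(v)\ge 0$. Let $\mathcal C_i=\sum_v c(v)$ and let $\mathcal L_i$ be the maximal length $\sum_{v\in\pi}c(v)$ of a path $\pi$ of this graph. Each job of $\tau_i$ accesses $\ell_q$ at most $N_{i,q}$ times, each access holding the lock of $\ell_q$ for at most $L_{i,q}$ time units (included in the execution times); $\Theta_i=\{\ell_q : N_{i,q}>0\}$. Task $\tau_i$ is scheduled by a work-conserving scheduler on $m_i\ge 1$ processors of its own. Accesses are non-nested and lie within one vertex. A vertex that requests a lock held by another vertex spins (not counted as execution), and spinning and lock holding are non-preemptive. Tasks have distinct priorities. Locks are served in priority order: no request is granted while a request of a higher-priority task is spinning for the same resource. Requests of the same task are served among each other either in arbitrary order or in FIFO order. Let $\tau_i^H$ and $\tau_i^L$ be the sets of tasks with higher and lower priority than $\tau_i$. The response time of a job is its finish time minus its release time, and $R_i$ is the supremum of the response times of the jobs of $\tau_i$ in the run considered. Notation.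 Maxima over the empty set are $0$. If both $\tau_i$ and $\tau_j$ access $\ell_q$, put \[\eta_{i,j}^q=\left\lceil\frac{D_i+D_j}{T_j}\right\rceil,\qquad \varDelta_{i,j}^q=\left\lceil\frac{dpr(\tau_i,\ell_q)+D_j}{T_j}\right\rceil ,\] and otherwise $\eta_{i,j}^q=\varDelta_{i,j}^q=0$. Here the delay-per-request $dpr(\tau_i,\ell_q)$ is the least $d\ge 0$ with \[ d=\max_{\tau_j\in\tau_i^L}L_{j,q}+\sum_{\tau_j\in\tau_i^H}\left\lceil\frac{d+D_j}{T_j}\right\rceil N_{j,q}L_{j,q}+\kappa_{i,q}L_{i,q},\] with $\kappa_{i,q}=\min\{m_i,N_{i,q}\}-1$ if requests of one task are served in FIFO order and $\kappa_{i,q}=N_{i,q}-1$ if their order is arbitrary; if there is no such $d$, then $dpr(\tau_i,\ell_q)=\varDelta_{i,j}^q=\infty$. For an integer $x\in[0,N_{i,q}]$ let \[\mathcal P^I(x)=\bigl((N_{i,q}-x)(m_i-1)-\max\{1-x,0\}\Delta\bigr)L_{i,q},\qquad \Delta=\min\{N_{i,q},m_i\}\Bigl(m_i-\tfrac{\min\{N_{i,q},m_i\}+1}{2}\Bigr),\]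 \[\mathcal P^O_L(x)=\bigl(N_{i,q}+(m_i-1)x\bigr)\max_{\tau_j\in\tau_i^L}L_{j,q},\] \[\mathcal P^O_H(x)=\sum_{\tau_j\in\tau_i^H}\min\bigl\{m_i\eta_{i,j}^qN_{j,q},\ (N_{i,q}+(m_i-1)x)\varDelta_{i,j}^qN_{j,q}\bigr\}L_{j,q},\] $\mathcal P^O(x)=\mathcal P^O_L(x)+\mathcal P^O_H(x)$ (all depending on $i$ and $q$), and \[ R_i'=\frac{\mathcal C_i+(m_i-1)\mathcal L_i+\sum_{\ell_q\in\Theta_i}\max_{x\in[0,N_{i,q}]}\{\mathcal P^I(x)+\mathcal P^O(x)\}}{m_i}.\] Theorem. Consider a run of the system with priority-ordered spin locks such that, for every task $\tau_k$, all jobs of $\tau_k$ meet their deadlines ($R_k\le D_k$) or $R_k'\le D_k$. Then $R_i\le R_i'$ for every task $\tau_i$. -/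

import Mathlib

open scoped NNReal ENNReal

noncomputable section

/-- A piece of the code of a vertex: ordinary code (`res = none`), or one access to a resource
`q` executed while holding the lock of `q` (`res = some q`); `len` is its execution time. -/
structure Segment (ρ : Type*) where
  res : Option ρ
  len : ℝ

namespace Segment

variable {ρ : Type*}

/-- Execution time of a program (a list of consecutive segments), without spinning. -/
def total (l : List (Segment ρ)) : ℝ := (l.map Segment.len).sum

/-- The segment in which a program stands after having executed for `w` time units. -/
def current : List (Segment ρ) → ℝ → Option (Segment ρ)
  | [], _ => none
  | s :: l, w => if w < s.len then some s else current l (w - s.len)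

/-- The amount of execution after which the segment that is current at `w` is completed. -/
def currentEnd : List (Segment ρ) → ℝ → ℝ
  | [], _ => 0
  | s :: l, w => if w < s.len then s.len else s.len + currentEnd l (w - s.len)

open Classical in
/-- Number of accesses to `q` in a program. -/
def accesses (l : List (Segment ρ)) (q : ρ) : ℕ :=
  l.countP fun s => decide (s.res = some q)

end Segment

/-- A set of DAG tasks (indexed by `ι`) with constrained deadlines, sharing resources (indexed
by `ρ`), where task `i` has `m i` dedicated processors. A larger `prio` is a higher priority. -/
structure TaskSystem (ι ρ : Type*) where
  V : ι → Type*
  fintypeV : ∀ i, Fintype (V i)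
  E : ∀ i, V i → V i → Prop
  acyclic : ∀ i v, ¬ Relation.TransGen (E i) v v
  /-- worst-case execution time of a vertex, resource accesses included, spinning excluded -/
  c : ∀ i, V i → ℝ≥0
  T : ι → ℝ
  D : ι → ℝ
  D_pos : ∀ i, 0 < D i
  D_le_T : ∀ i, D i ≤ T i
  m : ι → ℕ
  m_pos : ∀ i, 0 < m i
  /-- worst-case number of accesses to a resource by one job of the task -/
  N : ι → ρ → ℕ
  /-- worst-case duration of one access to a resource by the task -/
  L : ι → ρ → ℝ≥0
  prio : ι → ℕ
  prio_injective : Function.Injective prio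

attribute [instance] TaskSystem.fintypeV

/-- How requests of equal priority, i.e. of the same task, are ordered among each other. -/
inductive TieBreak
  | arbitrary
  | fifo

namespace TaskSystem

variable {ι ρ : Type*} (S : TaskSystem ι ρ)

/-! ### Runs of the system -/

/-- Vertex instances: vertex `v` of the `k`-th job of task `i` is `⟨i, (k, v)⟩`. -/
abbrev Inst : Type _ := Σ i : ι, ℕ × S.V i

/-- The data of a run of the system over the time axis `ℝ`. -/
structure Run where
  /-- release time of the `k`-th job of task `i` -/
  release : ι → ℕ → ℝ
  /-- the code that a vertex instance actually executes -/
  prog : S.Inst → List (Segment ρ)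
  /-- the vertex instance with which a processor of task `i` is busy (`none`: idle) -/
  sched : ∀ i, Fin (S.m i) → ℝ → Option (ℕ × S.V i)
  /-- the vertex instance holding the lock of a resource -/
  holder : ρ → ℝ → Option S.Inst
  /-- the amount of its code that a vertex instance has executed before a time point -/
  work : S.Inst → ℝ → ℝ

namespace Run

variable {S} (σ : S.Run)

/-- Some processor is busy with `x` (executing it or spinning on its behalf). -/
def OnProc (x : S.Inst) (t : ℝ) : Prop := ∃ p, σ.sched x.1 p t = some x.2

/-- The next piece of code of `x` is (the rest of) an access to `q`. -/
def AtAccess (x : S.Inst) (q : ρ) (t : ℝ) : Prop :=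
  ∃ s, Segment.current (σ.prog x) (σ.work x t) = some s ∧ s.res = some q

/-- `x` spins for the lock of `q`. -/
def Spinning (x : S.Inst) (q : ρ) (t : ℝ) : Prop :=
  σ.OnProc x t ∧ σ.AtAccess x q t ∧ σ.holder q t ≠ some x

/-- `x` executes, with or without holding a lock. -/
def Executing (x : S.Inst) (t : ℝ) : Prop :=
  σ.OnProc x t ∧ ∀ q, ¬ σ.Spinning x q t

/-- Between `t` and `t'`, `x` has not left the segment in which it stands at time `t`. -/
def SameSegment (x : S.Inst) (t t' : ℝ) : Prop :=
  σ.work x t' < Segment.currentEnd (σ.prog x) (σ.work x t)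

/-- Vertex `v` of job `k` of task `i` is finished: it and all its ancestors have executed all
their code (so that a vertex without code finishes when its predecessors have finished). -/
def Finished (i : ι) (k : ℕ) (v : S.V i) (t : ℝ) : Prop :=
  σ.release i k ≤ t ∧ ∀ u, Relation.ReflTransGen (S.E i) u v →
    Segment.total (σ.prog ⟨i, (k, u)⟩) ≤ σ.work ⟨i, (k, u)⟩ t

/-- All predecessors are finished. -/
def Eligible (i : ι) (k : ℕ) (v : S.V i) (t : ℝ) : Prop :=
  σ.release i k ≤ t ∧ ∀ u, S.E i u v → σ.Finished i k u t

/-- The `k`-th job of task `i` is finished. -/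
def JobFinished (i : ι) (k : ℕ) (t : ℝ) : Prop :=
  σ.release i k ≤ t ∧ ∀ v, σ.Finished i k v t

/-- The response time of a job (`⊤` if it never finishes). -/
def responseTime (i : ι) (k : ℕ) : ℝ≥0∞ :=
  ⨅ t ∈ {t : ℝ | σ.JobFinished i k t}, ENNReal.ofReal (t - σ.release i k)

/-- The worst-case response time of a task: the supremum over all its jobs. -/
def wcrt (i : ι) : ℝ≥0∞ := ⨆ k, σ.responseTime i k

/-- The run respects the task parameters, the precedence constraints, work-conserving scheduling
of each task on its own processors, and the rules of non-nested, non-preemptive spin locks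
(with no assumption on the order in which requests are served). -/
structure IsLegal : Prop where
  /-- consecutive releases are at least one period apart -/
  period : ∀ i k, σ.release i k + S.T i ≤ σ.release i (k + 1)
  len_pos : ∀ x, ∀ s ∈ σ.prog x, 0 < s.len
  wcet : ∀ i k v, Segment.total (σ.prog ⟨i, (k, v)⟩) ≤ S.c i v
  accesses_le : ∀ i k q, ∑ v, Segment.accesses (σ.prog ⟨i, (k, v)⟩) q ≤ S.N i q
  access_len : ∀ x, ∀ s ∈ σ.prog x, ∀ q, s.res = some q → s.len ≤ S.L x.1 q
  sched_measurable : ∀ i p y, MeasurableSet {t | σ.sched i p t = some y}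
  /-- a vertex makes progress exactly while it executes -/
  work_eq : ∀ x t, σ.work x t = MeasureTheory.volume.real {s | s < t ∧ σ.Executing x s}
  /-- only eligible vertices that still have code to execute are scheduled -/
  sched_eligible : ∀ i p k v t, σ.sched i p t = some (k, v) →
    σ.Eligible i k v t ∧ σ.work ⟨i, (k, v)⟩ t < Segment.total (σ.prog ⟨i, (k, v)⟩)
  /-- no vertex occupies two processors at a time -/
  sched_injective : ∀ i p p' y t, σ.sched i p t = some y → σ.sched i p' t = some y → p = p'
  /-- if an eligible unfinished vertex is not scheduled, then no processor of its task is idle -/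
  work_conserving : ∀ i k v t, σ.Eligible i k v t → ¬ σ.Finished i k v t →
    ¬ σ.OnProc ⟨i, (k, v)⟩ t → ∀ p, σ.sched i p t ≠ none
  /-- spinning and holding a lock are non-preemptive -/
  nonpreemptive : ∀ i p k v q t t', σ.sched i p t = some (k, v) → σ.AtAccess ⟨i, (k, v)⟩ q t →
    t ≤ t' → σ.SameSegment ⟨i, (k, v)⟩ t t' → σ.sched i p t' = some (k, v)
  /-- a lock is held only by a scheduled vertex that is accessing the resource -/
  holder_access : ∀ q x t, σ.holder q t = some x → σ.OnProc x t ∧ σ.AtAccess x q t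
  /-- a lock is held until the access is completed -/
  holder_keeps : ∀ q x t t', σ.holder q t = some x → t ≤ t' → σ.SameSegment x t t' →
    σ.holder q t' = some x
  /-- a vertex spins for a lock only while another vertex holds it -/
  spinning_held : ∀ x q t, σ.Spinning x q t → σ.holder q t ≠ none

/-- Priority-ordered locks: no request of a lower-priority task is granted while a request of a
higher-priority task is spinning. That is, if the same request of `x` spins for `q` at `t` and at
`t' ≥ t`, and a lower-priority `y` holds `q` at `t'`, then this access of `y` was already holding
the lock at `t`. (While `x` spins, `work x` is constant, which identifies its request.) -/
def PriorityOrdered : Prop :=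
  ∀ q x y t t', t ≤ t' → σ.Spinning x q t → σ.Spinning x q t' → σ.work x t = σ.work x t' →
    S.prio y.1 < S.prio x.1 → σ.holder q t' = some y →
    σ.holder q t = some y ∧ σ.SameSegment y t t'

/-- The order among requests of one task. Under `fifo`, a request of `y` that is granted the lock
while a request of `x` of the same task is spinning must not have been issued later than that
request: it was already being spun for, or served, whenever `x` was spinning for its request. -/
def RespectsTies : TieBreak → Prop
  | .arbitrary => True
  | .fifo => ∀ q x y t t', t ≤ t' → σ.Spinning x q t → σ.Spinning x q t' →
      σ.work x t = σ.work x t' → y.1 = x.1 → σ.holder q t' = some y →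
      σ.OnProc y t ∧ σ.AtAccess y q t ∧ σ.SameSegment y t t'

end Run

/-! ### The quantities of the response time bound -/

/-- Total worst-case execution time of the task. -/
def totalWCET (i : ι) : ℝ := ∑ v, (S.c i v : ℝ)

/-- The length of a longest path of the DAG of the task. -/
def longestPath (i : ι) : ℝ :=
  sSup {ℓ : ℝ | ∃ π : List (S.V i), π.IsChain (S.E i) ∧ ℓ = (π.map fun v => (S.c i v : ℝ)).sum}

section Bound

variable [Fintype ι] [Fintype ρ]

/-- The tasks with a higher priority. -/
def higher (i : ι) : Finset ι := Finset.univ.filter fun j => S.prio i < S.prio j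

/-- The tasks with a lower priority. -/
def lower (i : ι) : Finset ι := Finset.univ.filter fun j => S.prio j < S.prio i

/-- The resources accessed by the task. -/
def resources (i : ι) : Finset ρ := Finset.univ.filter fun q => 0 < S.N i q

/-- The largest access time to `q` among the lower-priority tasks (`0` if there are none). -/
def maxLower (i : ι) (q : ρ) : ℝ≥0 := (S.lower i).sup fun j => S.L j q

/-- `η`: the number of jobs of `j` that may contend for `q` with one job of `i`. -/
def eta (i j : ι) (q : ρ) : ℕ :=
  if 0 < S.N i q ∧ 0 < S.N j q then ⌈(S.D i + S.D j) / S.T j⌉₊ else 0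

/-- The number of other requests of the same job that may be served before a given request. -/
def ownRequests (tie : TieBreak) (i : ι) (q : ρ) : ℕ :=
  match tie with
  | .arbitrary => S.N i q - 1
  | .fifo => min (S.m i) (S.N i q) - 1

/-- The delay of one request of `i` for `q` caused by one lower-priority access, by the jobs of
the higher-priority tasks that are active in a window of length `d`, and by the task itself. -/
def dprStep (tie : TieBreak) (i : ι) (q : ρ) (d : ℝ) : ℝ :=
  S.maxLower i q
    + ∑ j ∈ S.higher i, (⌈(d + S.D j) / S.T j⌉₊ : ℝ) * S.N j q * S.L j q
    + S.ownRequests tie i q * S.L i q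

/-- The fixed points of the delay-per-request recurrence. -/
def dprFixedPoints (tie : TieBreak) (i : ι) (q : ρ) : Set ℝ :=
  {d | 0 ≤ d ∧ S.dprStep tie i q d = d}

/-- The delay-per-request: the least fixed point of the recurrence, if there is one. -/
def dpr (tie : TieBreak) (i : ι) (q : ρ) : ℝ := sInf (S.dprFixedPoints tie i q)

open Classical in
/-- `Δ`: the number of jobs of `j` that may contend for `q` with a single request of `i`
(`⊤` if the delay-per-request recurrence has no fixed point). -/
def jobsPerRequest (tie : TieBreak) (i j : ι) (q : ρ) : ℕ∞ :=
  if 0 < S.N i q ∧ 0 < S.N j q then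
    if (S.dprFixedPoints tie i q).Nonempty then
      (⌈(S.dpr tie i q + S.D j) / S.T j⌉₊ : ℕ∞)
    else ⊤
  else 0

/-- The intra-task term `P^I(x)`. -/
def intraTerm (i : ι) (q : ρ) (x : ℕ) : ℝ :=
  let α : ℝ := min (S.N i q : ℝ) (S.m i)
  (((S.N i q : ℝ) - x) * ((S.m i : ℝ) - 1)
    - max (1 - (x : ℝ)) 0 * (α * ((S.m i : ℝ) - (α + 1) / 2))) * S.L i q

/-- The term `P^O_L(x)` of the lower-priority tasks. -/
def lowerTerm (i : ι) (q : ρ) (x : ℕ) : ℝ :=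
  ((S.N i q : ℝ) + ((S.m i : ℝ) - 1) * x) * S.maxLower i q

/-- The term `P^O_H(x)` of the higher-priority tasks. The minimum is taken in `ℕ∞`; it is finite
because its first argument is. -/
def higherTerm (tie : TieBreak) (i : ι) (q : ρ) (x : ℕ) : ℝ :=
  ∑ j ∈ S.higher i,
    ((min ((S.m i * S.eta i j q * S.N j q : ℕ) : ℕ∞)
      (((S.N i q + (S.m i - 1) * x : ℕ) : ℕ∞) * S.jobsPerRequest tie i j q * S.N j q)).toNat : ℝ)
      * S.L j q

/-- The response time bound for priority-ordered spin locks. -/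
def responseBound (tie : TieBreak) (i : ι) : ℝ :=
  (S.totalWCET i + ((S.m i : ℝ) - 1) * S.longestPath i
    + ∑ q ∈ S.resources i,
        (Finset.range (S.N i q + 1)).sup' Finset.nonempty_range_add_one fun x =>
          S.intraTerm i q x + (S.lowerTerm i q x + S.higherTerm tie i q x)) / S.m i

end Bound

end TaskSystem

end

/-! Consider a job of $\tau_i$ released at $r$ and still unfinished at some $t\le r+D_i$, where all
deadlines before $t$ are met. Tracing unfinished predecessors backwards gives a key path $P$ that
contains an eligible unfinished vertex at every time in $[r,t)$ (`exists_keyPath`). By work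
conservation, at each such time $m_i$ is at most the number of executing vertices, plus $m_i-1$
times the number of executing vertices of $P$, plus a blocking charge for each resource
(`m_le_executing_add_blocking`). Integration gives $m_i(t-r)<\mathcal C_i+(m_i-1)\mathcal
L_i+\sum_q\int\text{blocking}_q$; it is strict because some work is missing.

Let $x$ be the number of accesses to $\ell_q$ on $P$. The charge is split by the task that holds the
lock (`upperIntegralLE_blocking`). If it is $\tau_i$ itself, the access being served lies off $P$
and blocks at most $m_i-1$ processors; for $x=0$ it blocks at most as many as there are requests
left, which yields the correction $\Delta$. If it is another task, a request on $P$ is charged with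
weight $m_i$ and any other with weight $1$, in total $N_{i,q}+(m_i-1)x$. Priority order lets one
lower-priority access delay each request, and `sub_lt_of_fixedPoint` confines a request to a window
of length $dpr$, in which few jobs of a higher-priority task are active.

Counting active jobs relies on deadlines being met. This circularity is broken by looking at the
earliest missed deadline (`jobFinished_deadline`).

Sets of times are bounded in outer measure only, so the sets of spinning or holding times need not
be shown measurable. -/

open MeasureTheory

/-! ### Programs: prefix lengths and positions of accesses. -/

namespace Segment

variable {ρ : Type*}

/-- Execution time of the first `n` segments of a program. -/
noncomputable def start (l : List (Segment ρ)) (n : ℕ) : ℝ := total (l.take n)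

theorem start_zero (l : List (Segment ρ)) : start l 0 = 0 := by simp [start, total]

theorem start_cons_succ (s : Segment ρ) (l : List (Segment ρ)) (n : ℕ) :
    start (s :: l) (n + 1) = s.len + start l n := by simp [start, total]

theorem start_succ {l : List (Segment ρ)} {n : ℕ} (h : n < l.length) :
    start l (n + 1) = start l n + l[n].len := by
  rw [start, start, total, total, List.take_succ_eq_append_getElem h,
    List.map_append, List.sum_append]
  simp

theorem start_nonneg {l : List (Segment ρ)} (hl : ∀ s ∈ l, 0 < s.len) (n : ℕ) :
    0 ≤ start l n := by
  refine List.sum_nonneg fun a ha => ?_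
  obtain ⟨s, hs, rfl⟩ := List.mem_map.1 ha
  exact (hl s (List.mem_of_mem_take hs)).le

theorem start_mono {l : List (Segment ρ)} (hl : ∀ s ∈ l, 0 < s.len) : Monotone (start l) := by
  refine monotone_nat_of_le_succ fun n => ?_
  by_cases h : n < l.length
  · rw [start_succ h]
    linarith [hl _ (List.getElem_mem h)]
  · rw [start, start, List.take_of_length_le (by omega), List.take_of_length_le (by omega)]

theorem current_eq_some {l : List (Segment ρ)} {w : ℝ} {s : Segment ρ} (hw : 0 ≤ w)
    (h : current l w = some s) :
    ∃ n, l[n]? = some s ∧ start l n ≤ w ∧ w < start l (n + 1) := by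
  induction l generalizing w with
  | nil => simp [current] at h
  | cons a l ih =>
    rw [current] at h
    split_ifs at h with hlt
    · refine ⟨0, by simpa using h, by simpa [start_zero] using hw, ?_⟩
      rw [start_cons_succ, start_zero]
      linarith
    · obtain ⟨n, h₁, h₂, h₃⟩ := ih (by linarith) h
      refine ⟨n + 1, by simpa using h₁, ?_, ?_⟩ <;> rw [start_cons_succ] <;> linarith

/-- Since segments have positive length, the intervals between consecutive prefix lengths are
disjoint. An access can thus be tracked by its index instead of by `current`. -/
theorem current_of_start_le {l : List (Segment ρ)} (hl : ∀ s ∈ l, 0 < s.len) {w : ℝ}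
    {s : Segment ρ} {n : ℕ} (hn : l[n]? = some s) (h₁ : start l n ≤ w)
    (h₂ : w < start l (n + 1)) :
    current l w = some s ∧ currentEnd l w = start l (n + 1) := by
  induction l generalizing w n with
  | nil => simp at hn
  | cons a l ih =>
    have hl' : ∀ s ∈ l, 0 < s.len := fun s hs => hl s (List.mem_cons_of_mem _ hs)
    rw [current, currentEnd]
    rw [start_cons_succ] at h₂ ⊢
    cases n with
    | zero =>
      rw [start_zero] at h₂ ⊢
      have : w < a.len := by linarith
      simp only [this, if_true]
      exact ⟨by simpa using hn, by simp⟩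
    | succ n =>
      rw [start_cons_succ] at h₁
      have : ¬ w < a.len := by linarith [start_nonneg hl' n]
      simp only [this, if_false]
      obtain ⟨h₃, h₄⟩ := ih hl' (by simpa using hn) (by linarith) (w := w - a.len) (by linarith)
      exact ⟨h₃, by rw [h₄]⟩

open Classical in
/-- The positions of the accesses to `q` in a program. -/
noncomputable def accessIndices (l : List (Segment ρ)) (q : ρ) : Finset ℕ :=
  (Finset.range l.length).filter fun n => ∃ s, l[n]? = some s ∧ s.res = some q

theorem mem_accessIndices {l : List (Segment ρ)} {q : ρ} {n : ℕ} :
    n ∈ accessIndices l q ↔ ∃ s, l[n]? = some s ∧ s.res = some q := by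
  simp only [accessIndices, Finset.mem_filter, Finset.mem_range, and_iff_right_iff_imp]
  rintro ⟨s, hs, -⟩
  exact (List.getElem?_eq_some_iff.1 hs).1

theorem card_accessIndices (l : List (Segment ρ)) (q : ρ) :
    (accessIndices l q).card = accesses l q := by
  classical
  induction l with
  | nil => simp [accessIndices, accesses]
  | cons a l ih =>
    have : accessIndices (a :: l) q =
        (if a.res = some q then {0} else ∅) ∪
          (accessIndices l q).map ⟨Nat.succ, Nat.succ_injective⟩ := by
      ext n
      cases n with
      | zero => by_cases h : a.res = some q <;> simp [mem_accessIndices, h]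
      | succ n => by_cases h : a.res = some q <;> simp [mem_accessIndices, h]
    rw [this, Finset.card_union_of_disjoint, Finset.card_map, ih, accesses, accesses,
      List.countP_cons]
    · by_cases h : a.res = some q <;> simp [h]
      omega
    · by_cases h : a.res = some q <;> simp [h]

end Segment

/-! ### Executed work as a function of time, and individual requests. -/

namespace TaskSystem.Run

variable {ι ρ : Type*} {S : TaskSystem ι ρ} {σ : S.Run}

/-- The `n`-th segment of `x` is an access to `q` and is the segment in which `x` stands. -/
def AtRequest (σ : S.Run) (x : S.Inst) (n : ℕ) (q : ρ) (t : ℝ) : Prop :=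
  n ∈ Segment.accessIndices (σ.prog x) q ∧ Segment.start (σ.prog x) n ≤ σ.work x t ∧
    σ.work x t < Segment.start (σ.prog x) (n + 1)

/-- `x` spins for `q` on behalf of the access that is its `n`-th segment. -/
def SpinRequest (σ : S.Run) (x : S.Inst) (n : ℕ) (q : ρ) (t : ℝ) : Prop :=
  σ.Spinning x q t ∧ σ.AtRequest x n q t

theorem AtAccess.resource_unique {x : S.Inst} {q q' : ρ} {t : ℝ} (hx : σ.AtAccess x q t)
    (hx' : σ.AtAccess x q' t) : q = q' := by
  obtain ⟨s, hs, hq⟩ := hx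
  obtain ⟨s', hs', hq'⟩ := hx'
  rw [hs, Option.some_inj] at hs'
  rw [← hs', hq] at hq'
  exact Option.some_inj.1 hq'

namespace IsLegal

variable (h : σ.IsLegal)
include h

theorem eligible_and_work_lt {x : S.Inst} {t : ℝ} (hx : σ.OnProc x t) :
    σ.Eligible x.1 x.2.1 x.2.2 t ∧ σ.work x t < Segment.total (σ.prog x) := by
  obtain ⟨p, hp⟩ := hx
  exact h.sched_eligible x.1 p x.2.1 x.2.2 t hp

theorem release_le {x : S.Inst} {t : ℝ} (hx : σ.OnProc x t) : σ.release x.1 x.2.1 ≤ t :=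
  (h.eligible_and_work_lt hx).1.1

theorem executing_subset (x : S.Inst) (t : ℝ) :
    {s | s < t ∧ σ.Executing x s} ⊆ Set.Ico (σ.release x.1 x.2.1) t :=
  fun _ hs => ⟨h.release_le hs.2.1, hs.1⟩

theorem volume_executing_ne_top (x : S.Inst) (t : ℝ) :
    volume {s | s < t ∧ σ.Executing x s} ≠ ⊤ :=
  ((measure_mono (h.executing_subset x t)).trans_lt (by simp)).ne

theorem work_nonneg (x : S.Inst) (t : ℝ) : 0 ≤ σ.work x t := by
  rw [h.work_eq]; exact measureReal_nonneg

theorem work_of_le_release {x : S.Inst} {t : ℝ} (ht : t ≤ σ.release x.1 x.2.1) :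
    σ.work x t = 0 := by
  rw [h.work_eq, Set.subset_eq_empty (h.executing_subset x t) (Set.Ico_eq_empty (not_lt.2 ht))]
  simp

/-- Outer measure is additive when cut along the measurable set `Set.Iio t`, even if the executing
times are not measurable. -/
theorem work_eq_add {x : S.Inst} {t t' : ℝ} (ht : t ≤ t') :
    σ.work x t' = σ.work x t + volume.real {s | s ∈ Set.Ico t t' ∧ σ.Executing x s} := by
  rw [h.work_eq, h.work_eq,
    ← measureReal_inter_add_sdiff (measurableSet_Iio (a := t)) (h.volume_executing_ne_top x t')]
  congr 2
  · ext s; simp only [Set.mem_inter_iff, Set.mem_ofPred_eq, Set.mem_Iio]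
    exact ⟨fun hs => ⟨hs.2, hs.1.2⟩, fun hs => ⟨⟨hs.1.trans_le ht, hs.2⟩, hs.1⟩⟩
  · ext s; simp only [Set.mem_sdiff, Set.mem_ofPred_eq, Set.mem_Iio, not_lt, Set.mem_Ico]
    tauto

theorem work_mono (x : S.Inst) : Monotone (σ.work x) := fun t t' ht => by
  rw [h.work_eq_add ht]; linarith [measureReal_nonneg (μ := volume)
    (s := {s | s ∈ Set.Ico t t' ∧ σ.Executing x s})]

theorem work_le_add {x : S.Inst} {t t' : ℝ} (ht : t ≤ t') :
    σ.work x t' ≤ σ.work x t + (t' - t) := by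
  rw [h.work_eq_add ht]
  have : volume.real {s | s ∈ Set.Ico t t' ∧ σ.Executing x s} ≤ volume.real (Set.Ico t t') :=
    measureReal_mono (fun s hs => hs.1) (by simp)
  rw [Real.volume_real_Ico_of_le ht] at this
  linarith

theorem work_continuous (x : S.Inst) : Continuous (σ.work x) := by
  refine (LipschitzWith.of_le_add fun t t' => ?_).continuous
  rcases le_total t t' with ht | ht
  · exact (h.work_mono x ht).trans (by linarith [dist_nonneg (x := t) (y := t')])
  · rw [Real.dist_eq, abs_of_nonneg (by linarith)]
    exact h.work_le_add ht

/-- While the executed work of `x` stays in `[a, b]`, `x` executes for at most `b - a`. -/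
theorem volume_le_of_work_mem {x : S.Inst} {A : Set ℝ} {a b u v : ℝ} (hA : A ⊆ Set.Icc u v)
    (hex : ∀ s ∈ A, σ.Executing x s) (hw : ∀ s ∈ A, σ.work x s ∈ Set.Icc a b) :
    volume A ≤ ENNReal.ofReal (b - a) := by
  rcases A.eq_empty_or_nonempty with rfl | hne
  · simp
  have hbb : BddBelow A := ⟨u, fun s hs => (hA hs).1⟩
  have hba : BddAbove A := ⟨v, fun s hs => (hA hs).2⟩
  -- By continuity the bounds on the work persist at `sInf A` and `sSup A`, and the work gained
  -- between these two times is the execution time in between.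
  have hcl : ∀ s ∈ closure A, σ.work x s ∈ Set.Icc a b := fun s hs =>
    closure_minimal hw (isClosed_Icc.preimage (h.work_continuous x)) hs
  have h₀ := hcl _ (csInf_mem_closure hne hbb)
  have h₁ := hcl _ (csSup_mem_closure hne hba)
  have hle : sInf A ≤ sSup A := csInf_le_csSup hne hbb hba
  have hadd := h.work_eq_add (x := x) hle
  have hsub : A ⊆ {s | s ∈ Set.Ico (sInf A) (sSup A) ∧ σ.Executing x s} ∪ {sSup A} := by
    intro s hs
    rcases (le_csSup hba hs).lt_or_eq with hlt | heq
    · exact Or.inl ⟨⟨csInf_le hbb hs, hlt⟩, hex s hs⟩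
    · exact Or.inr heq
  have hfin : volume {s | s ∈ Set.Ico (sInf A) (sSup A) ∧ σ.Executing x s} ≠ ⊤ :=
    ((measure_mono fun s hs => hs.1).trans_lt (b := volume (Set.Ico (sInf A) (sSup A)))
      (by simp)).ne
  calc volume A ≤ _ := measure_mono hsub
    _ ≤ volume {s | s ∈ Set.Ico (sInf A) (sSup A) ∧ σ.Executing x s} + volume {sSup A} :=
      measure_union_le _ _
    _ = ENNReal.ofReal (volume.real {s | s ∈ Set.Ico (sInf A) (sSup A) ∧ σ.Executing x s}) := by
      rw [ofReal_measureReal hfin]; simp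
    _ ≤ _ := ENNReal.ofReal_le_ofReal (by linarith [h₀.1, h₁.2])

theorem atAccess_iff {x : S.Inst} {q : ρ} {t : ℝ} :
    σ.AtAccess x q t ↔ ∃ n, σ.AtRequest x n q t := by
  constructor
  · rintro ⟨s, hs, hq⟩
    obtain ⟨n, h₁, h₂, h₃⟩ := Segment.current_eq_some (h.work_nonneg x t) hs
    exact ⟨n, Segment.mem_accessIndices.2 ⟨s, h₁, hq⟩, h₂, h₃⟩
  · rintro ⟨n, hn, h₂, h₃⟩
    obtain ⟨s, hs, hq⟩ := Segment.mem_accessIndices.1 hn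
    exact ⟨s, (Segment.current_of_start_le (h.len_pos x) hs h₂ h₃).1, hq⟩

theorem sameSegment_iff {x : S.Inst} {n : ℕ} {q : ρ} {t t' : ℝ} (hx : σ.AtRequest x n q t) :
    σ.SameSegment x t t' ↔ σ.work x t' < Segment.start (σ.prog x) (n + 1) := by
  obtain ⟨s, hs, hq⟩ := Segment.mem_accessIndices.1 hx.1
  rw [SameSegment, (Segment.current_of_start_le (h.len_pos x) hs hx.2.1 hx.2.2).2]

theorem atRequest_unique {x : S.Inst} {n n' : ℕ} {q q' : ρ} {t : ℝ} (hx : σ.AtRequest x n q t)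
    (hx' : σ.AtRequest x n' q' t) : n = n' := by
  by_contra hne
  rcases Nat.lt_or_gt_of_ne hne with hlt | hlt
  · linarith [hx.2.2, hx'.2.1, Segment.start_mono (h.len_pos x) (Nat.succ_le_of_lt hlt)]
  · linarith [hx'.2.2, hx.2.1, Segment.start_mono (h.len_pos x) (Nat.succ_le_of_lt hlt)]

theorem atRequest_of_le {x : S.Inst} {n : ℕ} {q : ρ} {t t' : ℝ} (hx : σ.AtRequest x n q t)
    (ht : t ≤ t') (hw : σ.work x t' < Segment.start (σ.prog x) (n + 1)) :
    σ.AtRequest x n q t' :=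
  ⟨hx.1, hx.2.1.trans (h.work_mono x ht), hw⟩

theorem executing_of_holder {x : S.Inst} {q : ρ} {t : ℝ} (hx : σ.holder q t = some x) :
    σ.Executing x t := by
  obtain ⟨hon, hat⟩ := h.holder_access q x t hx
  refine ⟨hon, fun q' hs => hs.2.2 ?_⟩
  rw [← hat.resource_unique hs.2.1, hx]

/-- A lock granted in between would be kept until the access ends, which contradicts spinning for
the same access at `t'`. -/
theorem spinning_of_le_of_le {x : S.Inst} {n : ℕ} {q : ρ} {t t' s : ℝ}
    (hx : σ.SpinRequest x n q t) (hx' : σ.SpinRequest x n q t') (h₁ : t ≤ s) (h₂ : s ≤ t') :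
    σ.SpinRequest x n q s := by
  have hs : σ.AtRequest x n q s :=
    h.atRequest_of_le hx.2 h₁ ((h.work_mono x h₂).trans_lt hx'.2.2.2)
  obtain ⟨p, hp⟩ := hx.1.1
  refine ⟨⟨⟨p, ?_⟩, h.atAccess_iff.2 ⟨n, hs⟩, fun hh => hx'.1.2.2 ?_⟩, hs⟩
  · exact h.nonpreemptive x.1 p x.2.1 x.2.2 q t s hp hx.1.2.1 h₁
      ((h.sameSegment_iff hx.2).2 hs.2.2)
  · exact h.holder_keeps q x s t' hh h₂ ((h.sameSegment_iff hs).2 hx'.2.2.2)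

/-- Translates equality of access indices into the equality of work by which `PriorityOrdered` and
`RespectsTies` identify a request. -/
theorem work_eq_of_spinRequest {x : S.Inst} {n : ℕ} {q : ρ} {t t' : ℝ}
    (hx : σ.SpinRequest x n q t) (hx' : σ.SpinRequest x n q t') (ht : t ≤ t') :
    σ.work x t = σ.work x t' := by
  rw [h.work_eq_add ht]
  have : {s | s ∈ Set.Ico t t' ∧ σ.Executing x s} = ∅ := by
    rw [Set.eq_empty_iff_forall_notMem]
    rintro s ⟨hs, hex⟩
    exact hex.2 q (h.spinning_of_le_of_le hx hx' hs.1 hs.2.le).1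
  rw [this]; simp

theorem exists_spinRequest {x : S.Inst} {q : ρ} {t : ℝ} (hx : σ.Spinning x q t) :
    ∃ n, σ.SpinRequest x n q t := by
  obtain ⟨n, hn⟩ := h.atAccess_iff.1 hx.2.1
  exact ⟨n, hx, hn⟩

theorem exists_holder_request {y : S.Inst} {q : ρ} {t : ℝ} (hy : σ.holder q t = some y) :
    ∃ n, σ.AtRequest y n q t :=
  h.atAccess_iff.1 (h.holder_access q y t hy).2

/-- Times at which only the accesses in `R` are served have measure at most `|R| C`. -/
theorem volume_le_of_holder {β : Type*} (R : Finset β) (y : β → S.Inst) (n : β → ℕ) {q : ρ}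
    {A : Set ℝ} {u v C K : ℝ} (hA : A ⊆ Set.Icc u v) (hC : ∀ b ∈ R, S.L (y b).1 q ≤ C)
    (hR : ∀ s ∈ A, ∃ b ∈ R, σ.holder q s = some (y b) ∧ σ.AtRequest (y b) (n b) q s)
    (hC₀ : 0 ≤ C) (hK : R.card ≤ K) :
    volume A ≤ ENNReal.ofReal (K * C) := by
  have hone : ∀ b ∈ R, volume {s | s ∈ A ∧ σ.holder q s = some (y b) ∧
      σ.AtRequest (y b) (n b) q s} ≤ ENNReal.ofReal C := by
    intro b hb
    rcases Set.eq_empty_or_nonempty {s | s ∈ A ∧ σ.holder q s = some (y b) ∧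
      σ.AtRequest (y b) (n b) q s} with he | ⟨s₀, hs₀⟩
    · rw [he]; simp
    refine (h.volume_le_of_work_mem (x := y b) (a := Segment.start (σ.prog (y b)) (n b))
      (b := Segment.start (σ.prog (y b)) (n b + 1)) (fun s hs => hA hs.1)
      (fun s hs => h.executing_of_holder hs.2.1) fun s hs => ⟨hs.2.2.2.1, hs.2.2.2.2.le⟩).trans ?_
    refine ENNReal.ofReal_le_ofReal (le_trans ?_ (hC b hb))
    obtain ⟨g, hg, hq⟩ := Segment.mem_accessIndices.1 hs₀.2.2.1
    obtain ⟨hlt, hg'⟩ := List.getElem?_eq_some_iff.1 hg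
    rw [Segment.start_succ hlt, hg', add_sub_cancel_left]
    exact h.access_len (y b) g (hg' ▸ List.getElem_mem hlt) q hq
  have hsub : A ⊆ ⋃ b ∈ R, {s | s ∈ A ∧ σ.holder q s = some (y b) ∧
      σ.AtRequest (y b) (n b) q s} := by
    intro s hs
    obtain ⟨b, hb, hs'⟩ := hR s hs
    exact Set.mem_biUnion (Finset.mem_coe.2 hb) ⟨hs, hs'⟩
  calc volume A ≤ _ := measure_mono hsub
    _ ≤ ∑ b ∈ R, _ := measure_biUnion_finset_le R _
    _ ≤ ∑ _b ∈ R, ENNReal.ofReal C := Finset.sum_le_sum hone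
    _ = ENNReal.ofReal (R.card * C) := by
      rw [Finset.sum_const, ENNReal.ofReal_mul (by positivity), nsmul_eq_mul]; simp
    _ ≤ _ := ENNReal.ofReal_le_ofReal (mul_le_mul_of_nonneg_right hK hC₀)

end IsLegal

end TaskSystem.Run

/-! ### Counting active jobs; delay of one request by lower-priority tasks and by its own job. -/

namespace TaskSystem.Run

variable {ι ρ : Type*} {S : TaskSystem ι ρ} {σ : S.Run}

/-- Every job whose absolute deadline is before `t` meets its deadline. -/
def MeetsDeadlinesBefore (σ : S.Run) (t : ℝ) : Prop :=
  ∀ j k, σ.release j k + S.D j < t → σ.JobFinished j k (σ.release j k + S.D j)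

/-- The accesses to `q` of the vertices in `P` of the `k`-th job of task `i`. -/
noncomputable def jobRequests (σ : S.Run) (i : ι) (k : ℕ) (q : ρ) (P : Finset (S.V i)) :
    Finset (Σ _ : S.V i, ℕ) :=
  P.sigma fun v => Segment.accessIndices (σ.prog ⟨i, (k, v)⟩) q

/-- The lock of `q` is held by a vertex of task `j`. -/
def HeldBy (σ : S.Run) (q : ρ) (j : ι) (t : ℝ) : Prop :=
  ∃ y : S.Inst, σ.holder q t = some y ∧ y.1 = j

theorem T_pos (S : TaskSystem ι ρ) (j : ι) : 0 < S.T j := (S.D_pos j).trans_le (S.D_le_T j)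

theorem mem_jobRequests {i : ι} {k : ℕ} {q : ρ} {P : Finset (S.V i)} {e : Σ _ : S.V i, ℕ} :
    e ∈ σ.jobRequests i k q P ↔
      e.1 ∈ P ∧ e.2 ∈ Segment.accessIndices (σ.prog ⟨i, (k, e.1)⟩) q := by
  simp [jobRequests]

theorem card_jobRequests (i : ι) (k : ℕ) (q : ρ) (P : Finset (S.V i)) :
    (σ.jobRequests i k q P).card = ∑ v ∈ P, Segment.accesses (σ.prog ⟨i, (k, v)⟩) q := by
  simp [jobRequests, Finset.card_sigma, Segment.card_accessIndices]

theorem card_onProc_le {i : ι} {k : ℕ} {s : ℝ} (P : Finset (S.V i))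
    (hP : ∀ v ∈ P, σ.OnProc ⟨i, (k, v)⟩ s) : P.card ≤ S.m i := by
  have hP' : ∀ v ∈ P, ∃ p : Fin (S.m i), σ.sched i p s = some (k, v) := hP
  have : Nonempty (Fin (S.m i)) := ⟨⟨0, S.m_pos i⟩⟩
  choose! f hf using hP'
  have := Finset.card_le_card_of_injOn (t := Finset.univ) f (fun _ _ => Finset.mem_univ _)
    fun v hv w hw he => by
      have e := hf v hv
      rw [he, hf w hw] at e
      simpa using e.symm
  simpa using this

namespace IsLegal

variable (h : σ.IsLegal)
include h

theorem card_jobRequests_le (i : ι) (k : ℕ) (q : ρ) (P : Finset (S.V i)) :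
    (σ.jobRequests i k q P).card ≤ S.N i q := by
  rw [card_jobRequests]
  exact (Finset.sum_le_sum_of_subset (Finset.subset_univ P)).trans (h.accesses_le i k q)

theorem release_add_mul_le (j : ι) {k k' : ℕ} (hk : k ≤ k') :
    σ.release j k + ((k' - k : ℕ) : ℝ) * S.T j ≤ σ.release j k' := by
  obtain ⟨d, rfl⟩ := Nat.exists_eq_add_of_le hk
  rw [Nat.add_sub_cancel_left]
  clear hk
  induction d with
  | zero => simp
  | succ d ih => have := h.period j (k + d); push_cast; rw [← add_assoc]; linarith

theorem release_mono (j : ι) : Monotone (σ.release j) :=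
  monotone_nat_of_le_succ fun k => by linarith [h.period j k, T_pos S j]

/-- The jobs released in an interval `(a, b]` are consecutive and few. -/
theorem exists_released_subset (j : ι) {a b : ℝ} (K : Set ℕ)
    (hK : ∀ k ∈ K, a < σ.release j k ∧ σ.release j k ≤ b) :
    ∃ k₀, ∀ k ∈ K, k ∈ Finset.Ico k₀ (k₀ + ⌈(b - a) / S.T j⌉₊) := by
  classical
  rcases K.eq_empty_or_nonempty with rfl | hne
  · exact ⟨0, by simp⟩
  refine ⟨sInf K, fun k hk => Finset.mem_Ico.2 ⟨Nat.sInf_le hk, ?_⟩⟩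
  have h₀ := hK _ (Nat.sInf_mem hne)
  have h₁ := hK _ hk
  have h₂ := h.release_add_mul_le j (Nat.sInf_le hk)
  -- The interval is open at `a`, so the inequality is strict and the ceiling suffices without an
  -- extra job.
  have hlt : ((k - sInf K : ℕ) : ℝ) < (b - a) / S.T j := by
    rw [lt_div_iff₀ (T_pos S j)]; linarith
  have := Nat.lt_ceil.2 hlt
  omega

theorem lt_release_add {t s : ℝ} (hmet : σ.MeetsDeadlinesBefore t) (hs : s < t) {x : S.Inst}
    (hx : σ.OnProc x s) : s < σ.release x.1 x.2.1 + S.D x.1 := by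
  by_contra hle
  rw [not_lt] at hle
  have h₁ := ((hmet x.1 x.2.1 (hle.trans_lt hs)).2 x.2.2).2 x.2.2 .refl
  exact absurd ((h₁.trans (h.work_mono x hle)).trans_lt (h.eligible_and_work_lt hx).2) (lt_irrefl _)

/-- As $D_i\le T_i$ and earlier deadlines are met, two jobs of one task never overlap: before its
deadline, the job has all processors of the task to itself. -/
theorem job_eq {t s : ℝ} (hmet : σ.MeetsDeadlinesBefore t) {i : ι} {k : ℕ}
    (ht : t ≤ σ.release i k + S.D i) (hs : s ∈ Set.Ico (σ.release i k) t) {x : S.Inst}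
    (hx : σ.OnProc x s) (hi : x.1 = i) : x.2.1 = k := by
  subst hi
  by_contra hne
  have h₁ := h.lt_release_add hmet hs.2 hx
  have h₂ := h.release_le hx
  have hD := S.D_le_T x.1
  rcases Nat.lt_or_gt_of_ne hne with hlt | hlt
  · linarith [h.period x.1 x.2.1, h.release_mono x.1 (Nat.succ_le_of_lt hlt), hs.1]
  · linarith [h.period x.1 k, h.release_mono x.1 (Nat.succ_le_of_lt hlt), hs.2]

/-- Bound on the time during which task `j` holds `q`, if only the jobs in `K` do so. -/
theorem volume_heldBy_le {j : ι} {q : ρ} {A : Set ℝ} {u v : ℝ} (hA : A ⊆ Set.Icc u v)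
    (K : Finset ℕ) (hK : ∀ s ∈ A, ∀ y : S.Inst, σ.holder q s = some y → y.1 = j → y.2.1 ∈ K) :
    volume {s | s ∈ A ∧ σ.HeldBy q j s} ≤ ENNReal.ofReal (K.card * S.N j q * S.L j q) := by
  refine h.volume_le_of_holder (K.sigma fun k => σ.jobRequests j k q Finset.univ)
    (fun b => ⟨j, (b.1, b.2.1)⟩) (fun b => b.2.2) (fun s hs => hA hs.1) (fun _ _ => le_rfl)
    ?_ (S.L j q).2 ?_
  · rintro s ⟨hs, ⟨j', k, w⟩, hy, rfl⟩
    obtain ⟨n, hn⟩ := h.exists_holder_request hy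
    refine ⟨⟨k, ⟨w, n⟩⟩, ?_, hy, hn⟩
    simp only [Finset.mem_sigma, mem_jobRequests, Finset.mem_univ, true_and]
    exact ⟨hK s hs _ hy rfl, hn.1⟩
  · rw [Finset.card_sigma]
    have := Finset.sum_le_card_nsmul K (fun k => (σ.jobRequests j k q Finset.univ).card) (S.N j q)
      fun k _ => h.card_jobRequests_le j k q _
    rw [smul_eq_mul] at this
    exact_mod_cast this

/-- All three ceilings of the analysis come from here, each with a suitable interval of release
times. -/
theorem volume_heldBy_le_ceil {j : ι} {q : ρ} {A : Set ℝ} {u v a b : ℝ} (hA : A ⊆ Set.Icc u v)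
    (hrel : ∀ s ∈ A, ∀ k w, σ.holder q s = some ⟨j, (k, w)⟩ →
      a < σ.release j k ∧ σ.release j k ≤ b) :
    volume {s | s ∈ A ∧ σ.HeldBy q j s} ≤
      ENNReal.ofReal ((⌈(b - a) / S.T j⌉₊ : ℝ) * S.N j q * S.L j q) := by
  obtain ⟨k₀, hk₀⟩ := h.exists_released_subset j (a := a) (b := b)
    {k | ∃ s ∈ A, ∃ w, σ.holder q s = some ⟨j, (k, w)⟩}
    (fun k ⟨s, hs, w, hw⟩ => hrel s hs k w hw)
  have := h.volume_heldBy_le (q := q) (j := j) hA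
    (Finset.Ico k₀ (k₀ + ⌈(b - a) / S.T j⌉₊)) (by
      rintro s hs ⟨j', k', v⟩ hv rfl
      exact hk₀ k' ⟨s, hs, v, hv⟩)
  rwa [Nat.card_Ico, Nat.add_sub_cancel_left] at this

variable [Fintype ι]

/-- A spinning request is delayed by at most one lower-priority access. -/
theorem volume_lower_le (hprio : σ.PriorityOrdered) {x : S.Inst} {n : ℕ} {q : ρ} {A : Set ℝ}
    {u v : ℝ} (hA : A ⊆ Set.Icc u v) (hspin : ∀ s ∈ A, σ.SpinRequest x n q s) :
    volume {s | s ∈ A ∧ ∃ j ∈ S.lower x.1, σ.HeldBy q j s} ≤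
      ENNReal.ofReal (S.maxLower x.1 q) := by
  rcases Set.eq_empty_or_nonempty {s | s ∈ A ∧ ∃ j ∈ S.lower x.1, σ.HeldBy q j s} with
    he | ⟨s₀, hs₀, -, hj₀, y₀, hy₀, rfl⟩
  · rw [he]; simp
  obtain ⟨n₀, hn₀⟩ := h.exists_holder_request hy₀
  have hlow : ∀ y : S.Inst, y.1 ∈ S.lower x.1 → S.prio y.1 < S.prio x.1 := fun y hy => by
    simpa [lower] using hy
  have hle : (S.L y₀.1 q : ℝ) ≤ S.maxLower x.1 q := by
    exact_mod_cast Finset.le_sup (f := fun j => S.L j q) hj₀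
  have := h.volume_le_of_holder (q := q) (A := {s | s ∈ A ∧ ∃ j ∈ S.lower x.1, σ.HeldBy q j s})
    (C := S.maxLower x.1 q) (K := 1) {()} (fun _ => y₀) (fun _ => n₀) (fun s hs => hA hs.1)
    (fun _ _ => hle) ?_ (S.maxLower x.1 q).2 (by simp)
  · simpa using this
  rintro s ⟨hs, -, hj, y, hy, rfl⟩
  refine ⟨(), by simp, ?_⟩
  -- Of two times, the lower-priority access served at the later one was already being served at the
  -- earlier one. So it is the same access at every time of the set, whichever side of `s₀` the time
  -- lies on.
  rcases le_total s₀ s with hle | hle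
  · obtain ⟨h₁, h₂⟩ := hprio q x y s₀ s hle (hspin _ hs₀).1 (hspin _ hs).1
      (h.work_eq_of_spinRequest (hspin _ hs₀) (hspin _ hs) hle) (hlow y hj) hy
    rw [hy₀, Option.some_inj] at h₁
    subst h₁
    exact ⟨hy, h.atRequest_of_le hn₀ hle ((h.sameSegment_iff hn₀).1 h₂)⟩
  · obtain ⟨h₁, h₂⟩ := hprio q x y₀ s s₀ hle (hspin _ hs).1 (hspin _ hs₀).1
      (h.work_eq_of_spinRequest (hspin _ hs) (hspin _ hs₀) hle) (hlow y₀ hj₀) hy₀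
    obtain ⟨n', hn'⟩ := h.exists_holder_request h₁
    have : n' = n₀ := h.atRequest_unique
      (h.atRequest_of_le hn' hle ((h.sameSegment_iff hn').1 h₂)) hn₀
    exact ⟨h₁, this ▸ hn'⟩

omit [Fintype ι] in
/-- Bound on the delay of a request by the other requests of its job, counted from a time `t₀` at
which the request is spinning. -/
theorem volume_own_le {tie : TieBreak} (htie : σ.RespectsTies tie) {t t₀ : ℝ}
    (hmet : σ.MeetsDeadlinesBefore t) {i : ι} {k : ℕ} (ht : t ≤ σ.release i k + S.D i)
    {w : S.V i} {n : ℕ} {q : ρ} {A : Set ℝ} (hr : σ.release i k ≤ t₀) (hA : A ⊆ Set.Ico t₀ t)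
    (h₀ : σ.SpinRequest ⟨i, (k, w)⟩ n q t₀)
    (hspin : ∀ s ∈ A, σ.SpinRequest ⟨i, (k, w)⟩ n q s) :
    volume {s | s ∈ A ∧ σ.HeldBy q i s} ≤
      ENNReal.ofReal (S.ownRequests tie i q * S.L i q) := by
  classical
  set R := (σ.jobRequests i k q Finset.univ).erase ⟨w, n⟩ with hRdef
  have hmem : (⟨w, n⟩ : Σ _ : S.V i, ℕ) ∈ σ.jobRequests i k q Finset.univ :=
    mem_jobRequests.2 ⟨Finset.mem_univ _, h₀.2.1⟩
  have hRcard : R.card ≤ S.N i q - 1 := by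
    rw [hRdef, Finset.card_erase_of_mem hmem]
    exact Nat.sub_le_sub_right (h.card_jobRequests_le i k q _) 1
  have hhold : ∀ s ∈ A, ∀ y : S.Inst, σ.holder q s = some y → y.1 = i →
      ∃ w' n', y = ⟨i, (k, w')⟩ ∧ σ.AtRequest ⟨i, (k, w')⟩ n' q s ∧ w' ≠ w ∧
        (⟨w', n'⟩ : Σ _ : S.V i, ℕ) ∈ R := by
    rintro s hs ⟨i', k', w'⟩ hy rfl
    have hk : k' = k := h.job_eq hmet ht ⟨hr.trans (hA hs).1, (hA hs).2⟩
      (h.holder_access q _ s hy).1 rfl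
    subst hk
    obtain ⟨n', hn'⟩ := h.exists_holder_request hy
    have hne : w' ≠ w := by
      rintro rfl
      exact (hspin s hs).1.2.2 hy
    refine ⟨w', n', rfl, hn', hne, Finset.mem_erase.2 ⟨fun he => hne (congrArg Sigma.fst he), ?_⟩⟩
    exact mem_jobRequests.2 ⟨Finset.mem_univ _, hn'.1⟩
  cases tie with
  | arbitrary =>
    refine h.volume_le_of_holder R (fun b => ⟨i, (k, b.1)⟩) (fun b => b.2)
      (fun s hs => Set.Ico_subset_Icc_self (hA hs.1)) (fun _ _ => le_rfl) ?_ (S.L i q).2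
      (by exact_mod_cast hRcard)
    rintro s ⟨hs, y, hy, hyi⟩
    obtain ⟨w', n', rfl, hn', -, hR⟩ := hhold s hs y hy hyi
    exact ⟨_, hR, hy, hn'⟩
  | fifo =>
    -- Under FIFO, only requests already issued at `t₀` can overtake. Each of them occupies a
    -- processor other than that of `w`, hence at most $m_i-1$.
    set R' := R.filter fun b => b.1 ≠ w ∧ σ.OnProc ⟨i, (k, b.1)⟩ t₀ ∧
      σ.AtRequest ⟨i, (k, b.1)⟩ b.2 q t₀ with hR'def
    have hcard : R'.card ≤ S.m i - 1 := by
      have hinj : Set.InjOn Sigma.fst (R' : Set (Σ _ : S.V i, ℕ)) := by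
        rintro ⟨b, c⟩ hb ⟨b', c'⟩ hb' (rfl : b = b')
        have : c = c' := h.atRequest_unique (Finset.mem_filter.1 hb).2.2.2
          (Finset.mem_filter.1 hb').2.2.2
        rw [this]
      have hw : w ∉ R'.image Sigma.fst := by
        intro hmem
        obtain ⟨b, hb, rfl⟩ := Finset.mem_image.1 hmem
        exact (Finset.mem_filter.1 hb).2.1 rfl
      have := card_onProc_le (σ := σ) (k := k) (s := t₀)
        (insert w (R'.image Sigma.fst)) fun v hv => by
        rcases Finset.mem_insert.1 hv with rfl | hv
        · exact h₀.1.1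
        · obtain ⟨b, hb, rfl⟩ := Finset.mem_image.1 hv
          exact (Finset.mem_filter.1 hb).2.2.1
      rw [Finset.card_insert_of_notMem hw, Finset.card_image_of_injOn hinj] at this
      omega
    refine h.volume_le_of_holder R' (fun b => ⟨i, (k, b.1)⟩) (fun b => b.2)
      (fun s hs => Set.Ico_subset_Icc_self (hA hs.1)) (fun _ _ => le_rfl) ?_ (S.L i q).2 ?_
    · rintro s ⟨hs, y, hy, hyi⟩
      obtain ⟨w', n', rfl, hn', hne, hR⟩ := hhold s hs y hy hyi
      obtain ⟨f₁, f₂, f₃⟩ := htie q ⟨i, (k, w)⟩ ⟨i, (k, w')⟩ t₀ s (hA hs).1 h₀.1 (hspin s hs).1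
        (h.work_eq_of_spinRequest h₀ (hspin s hs) (hA hs).1) rfl hy
      obtain ⟨n'', hn''⟩ := h.atAccess_iff.1 f₂
      have : n'' = n' := h.atRequest_unique
        (h.atRequest_of_le hn'' (hA hs).1 ((h.sameSegment_iff hn'').1 f₃)) hn'
      subst this
      exact ⟨⟨w', n''⟩, Finset.mem_filter.2 ⟨hR, hne, f₁, hn''⟩, hy, hn'⟩
    · have : R'.card ≤ S.N i q - 1 := (Finset.card_filter_le _ _).trans hRcard
      have : R'.card ≤ min (S.m i) (S.N i q) - 1 := by omega
      exact_mod_cast this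

end IsLegal

end TaskSystem.Run

/-! ### The delay-per-request and the delay by higher-priority tasks. -/

namespace TaskSystem.Run

variable {ι ρ : Type*} {S : TaskSystem ι ρ} {σ : S.Run}

namespace IsLegal

variable (h : σ.IsLegal)
include h

/-- Work grows at rate at most one, so for a short while neither the spinning vertex nor the holder
can leave its access, and the holder stays the same. -/
theorem exists_spin_extension {x : S.Inst} {n : ℕ} {q : ρ} {u t : ℝ} (hu : u < t)
    (hx : σ.SpinRequest x n q u) :
    ∃ y ε, 0 < ε ∧ u + ε ≤ t ∧
      ∀ s ∈ Set.Ico u (u + ε), σ.SpinRequest x n q s ∧ σ.holder q s = some y := by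
  obtain ⟨y, hy⟩ := Option.ne_none_iff_exists'.1 (h.spinning_held x q u hx.1)
  obtain ⟨n', hn'⟩ := h.exists_holder_request hy
  have hyx : y ≠ x := by
    rintro rfl
    exact hx.1.2.2 hy
  obtain ⟨p, hp⟩ := hx.1.1
  have hgx := hx.2.2.2
  have hgy := hn'.2.2
  refine ⟨y, min (t - u) (min (Segment.start (σ.prog x) (n + 1) - σ.work x u)
    (Segment.start (σ.prog y) (n' + 1) - σ.work y u)), ?_, ?_, fun s hs => ?_⟩
  · refine lt_min (by linarith) (lt_min (by linarith) (by linarith))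
  · linarith [min_le_left (t - u) (min (Segment.start (σ.prog x) (n + 1) - σ.work x u)
      (Segment.start (σ.prog y) (n' + 1) - σ.work y u))]
  · have hsu : s - u < min (t - u) (min (Segment.start (σ.prog x) (n + 1) - σ.work x u)
        (Segment.start (σ.prog y) (n' + 1) - σ.work y u)) := by linarith [hs.2]
    rw [lt_min_iff, lt_min_iff] at hsu
    have hwx := h.work_le_add (x := x) hs.1
    have hwy := h.work_le_add (x := y) hs.1
    have hat := h.atRequest_of_le hx.2 hs.1 (by linarith [hsu.2.1])
    have hhold : σ.holder q s = some y :=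
      h.holder_keeps q y u s hy hs.1 ((h.sameSegment_iff hn').2 (by linarith [hsu.2.2]))
    refine ⟨⟨⟨⟨p, ?_⟩, h.atAccess_iff.2 ⟨n, hat⟩, ?_⟩, hat⟩, hhold⟩
    · exact h.nonpreemptive x.1 p x.2.1 x.2.2 q u s hp hx.1.2.1 hs.1
        ((h.sameSegment_iff hx.2).2 hat.2.2)
    · rw [hhold]
      simpa using hyx

variable [Fintype ι]

/-- A request spins for less than any fixed point of the delay-per-request recurrence. -/
theorem sub_lt_of_fixedPoint (hprio : σ.PriorityOrdered) {tie : TieBreak}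
    (htie : σ.RespectsTies tie) {t : ℝ} (hmet : σ.MeetsDeadlinesBefore t) {i : ι} {k : ℕ}
    (ht : t ≤ σ.release i k + S.D i) {w : S.V i} {n : ℕ} {q : ρ} {t₀ u : ℝ}
    (hr : σ.release i k ≤ t₀) (hu : u < t) (h₀ : σ.SpinRequest ⟨i, (k, w)⟩ n q t₀)
    (h₁ : σ.SpinRequest ⟨i, (k, w)⟩ n q u) {d : ℝ} (hd : d ∈ S.dprFixedPoints tie i q) :
    u - t₀ < d := by
  by_contra hle
  rw [not_lt] at hle
  have hd₀ : 0 ≤ d := hd.1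
  have hspin_d : σ.SpinRequest ⟨i, (k, w)⟩ n q (t₀ + d) :=
    h.spinning_of_le_of_le h₀ h₁ (by linarith) (by linarith)
  -- A window of length `d` would give no contradiction, as it may be filled exactly. The extension
  -- makes it longer than `d` but adds no new holder.
  obtain ⟨y, ε, hε, hεt, hy⟩ := h.exists_spin_extension (t := t) (by linarith) hspin_d
  set A := Set.Ico t₀ (t₀ + d + ε) with hAdef
  have hAt : A ⊆ Set.Ico t₀ t := Set.Ico_subset_Ico_right hεt
  have hA : A ⊆ Set.Icc t₀ t := hAt.trans Set.Ico_subset_Icc_self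
  have hspin : ∀ s ∈ A, σ.SpinRequest ⟨i, (k, w)⟩ n q s := by
    intro s hs
    rcases le_total s (t₀ + d) with hle | hle
    · exact h.spinning_of_le_of_le h₀ hspin_d hs.1 hle
    · exact (hy s ⟨hle, hs.2⟩).1
  have hhigh : ∀ j, volume {s | s ∈ A ∧ σ.HeldBy q j s} ≤
      ENNReal.ofReal ((⌈(d + S.D j) / S.T j⌉₊ : ℝ) * S.N j q * S.L j q) := by
    intro j
    have := h.volume_heldBy_le_ceil (q := q) (j := j) (a := t₀ - S.D j) (b := t₀ + d) hA (by
      intro s hs k' v hv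
      -- In the extension the holder is that of time `t₀ + d`, so every job counted was released by
      -- `t₀ + d` and the ceiling stays that of `d`.
      obtain ⟨s', hs', hle, hv'⟩ : ∃ s' ∈ A, s' ≤ t₀ + d ∧
          σ.holder q s' = some ⟨j, (k', v)⟩ := by
        rcases le_total s (t₀ + d) with hle | hle
        · exact ⟨s, hs, hle, hv⟩
        · refine ⟨t₀ + d, ⟨by linarith, by linarith⟩, le_rfl, ?_⟩
          rw [(hy _ ⟨le_rfl, by linarith⟩).2, ← hv, (hy s ⟨hle, hs.2⟩).2]
      have hon := (h.holder_access q _ s' hv').1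
      have e₁ := h.lt_release_add hmet (hAt hs').2 hon
      have e₂ := h.release_le hon
      simp only at e₁ e₂
      exact ⟨by linarith [hs'.1], by linarith⟩)
    rwa [show t₀ + d - (t₀ - S.D j) = d + S.D j by ring] at this
  have hlow := h.volume_lower_le hprio hA hspin
  have hown := h.volume_own_le htie hmet ht hr hAt h₀ hspin
  have hcover : A ⊆ ({s | s ∈ A ∧ ∃ j ∈ S.lower i, σ.HeldBy q j s} ∪
      ⋃ j ∈ S.higher i, {s | s ∈ A ∧ σ.HeldBy q j s}) ∪ {s | s ∈ A ∧ σ.HeldBy q i s} := by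
    intro s hs
    obtain ⟨z, hz⟩ := Option.ne_none_iff_exists'.1 (h.spinning_held _ q s (hspin s hs).1)
    rcases lt_trichotomy (S.prio z.1) (S.prio i) with hlt | heq | hlt
    · exact Or.inl (Or.inl ⟨hs, z.1, by simpa [lower] using hlt, z, hz, rfl⟩)
    · exact Or.inr ⟨hs, z, hz, S.prio_injective heq⟩
    · refine Or.inl (Or.inr ?_)
      exact Set.mem_biUnion (x := z.1) (by simpa [higher] using hlt) ⟨hs, z, hz, rfl⟩
  have hsum : volume A ≤ ENNReal.ofReal (S.dprStep tie i q d) := by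
    calc volume A ≤ _ := measure_mono hcover
      _ ≤ _ := measure_union_le _ _
      _ ≤ _ := add_le_add_left (measure_union_le _ _) _
      _ ≤ (ENNReal.ofReal (S.maxLower i q) + ∑ j ∈ S.higher i,
            ENNReal.ofReal ((⌈(d + S.D j) / S.T j⌉₊ : ℝ) * S.N j q * S.L j q)) +
          ENNReal.ofReal (S.ownRequests tie i q * S.L i q) := by
        exact add_le_add (add_le_add hlow ((measure_biUnion_finset_le _ _).trans
          (Finset.sum_le_sum fun j _ => hhigh j))) hown
      _ = _ := by
        rw [dprStep, ENNReal.ofReal_add (by positivity) (by positivity),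
          ENNReal.ofReal_add (by positivity) (by positivity),
          ENNReal.ofReal_sum_of_nonneg fun j _ => by positivity]
  -- The window has length `d + ε`, while the holders fill at most `dprStep d = d`.
  rw [hd.2, hAdef, Real.volume_Ico, ENNReal.ofReal_le_ofReal_iff hd₀] at hsum
  linarith

/-- Bound on the delay of one request by a higher-priority task. -/
theorem volume_higher_le (hprio : σ.PriorityOrdered) {tie : TieBreak}
    (htie : σ.RespectsTies tie) {t : ℝ} (hmet : σ.MeetsDeadlinesBefore t) {i : ι} {k : ℕ}
    (ht : t ≤ σ.release i k + S.D i) {w : S.V i} {n : ℕ} {q : ρ} (j : ι)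
    (hd : (S.dprFixedPoints tie i q).Nonempty) :
    volume {s | s ∈ Set.Ico (σ.release i k) t ∧ σ.SpinRequest ⟨i, (k, w)⟩ n q s ∧
      σ.HeldBy q j s} ≤
      ENNReal.ofReal ((⌈(S.dpr tie i q + S.D j) / S.T j⌉₊ : ℝ) * S.N j q * S.L j q) := by
  set A := {s | s ∈ Set.Ico (σ.release i k) t ∧ σ.SpinRequest ⟨i, (k, w)⟩ n q s} with hAdef
  have hA : A ⊆ Set.Icc (σ.release i k) t := fun s hs => Set.Ico_subset_Icc_self hs.1
  have hbb : BddBelow A := ⟨_, fun s hs => (hA hs).1⟩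
  -- The distance of two spinning times is below every fixed point, hence at most their infimum; it
  -- need not be known that the infimum is a fixed point or that `sInf A` lies in `A`.
  have hdiam : ∀ s ∈ A, s ≤ sInf A + S.dpr tie i q := by
    intro s hs
    have : s - S.dpr tie i q ≤ sInf A := by
      refine le_csInf ⟨s, hs⟩ fun s' hs' => ?_
      have : s - s' ≤ S.dpr tie i q := le_csInf hd fun d hd =>
        (h.sub_lt_of_fixedPoint hprio htie hmet ht hs'.1.1 hs.1.2 hs'.2 hs.2 hd).le
      linarith
    linarith
  have := h.volume_heldBy_le_ceil (q := q) (j := j) (a := sInf A - S.D j)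
    (b := sInf A + S.dpr tie i q) hA (by
      intro s hs k' v hv
      have hon := (h.holder_access q _ s hv).1
      have e₁ := h.lt_release_add hmet hs.1.2 hon
      have e₂ := h.release_le hon
      simp only at e₁ e₂
      exact ⟨by linarith [csInf_le hbb hs], e₂.trans (hdiam s hs)⟩)
  rw [show sInf A + S.dpr tie i q - (sInf A - S.D j) = S.dpr tie i q + S.D j by ring] at this
  convert this using 2
  ext s
  simp [hAdef, and_assoc]

omit [Fintype ι] in
/-- Bound on the time during which another task holds `q` while a job is pending. -/
theorem volume_window_le {t : ℝ} (hmet : σ.MeetsDeadlinesBefore t) {i : ι} {k : ℕ}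
    (ht : t ≤ σ.release i k + S.D i) {q : ρ} (j : ι) :
    volume {s | s ∈ Set.Ico (σ.release i k) t ∧ σ.HeldBy q j s} ≤
      ENNReal.ofReal ((⌈(S.D i + S.D j) / S.T j⌉₊ : ℝ) * S.N j q * S.L j q) := by
  have := h.volume_heldBy_le_ceil (q := q) (j := j) (A := Set.Ico (σ.release i k) t)
    (a := σ.release i k - S.D j) (b := σ.release i k + S.D i) Set.Ico_subset_Icc_self (by
      intro s hs k' v hv
      have hon := (h.holder_access q _ s hv).1
      have e₁ := h.lt_release_add hmet hs.2 hon
      have e₂ := h.release_le hon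
      simp only at e₁ e₂
      exact ⟨by linarith [hs.1], by linarith [hs.2]⟩)
  rwa [show σ.release i k + S.D i - (σ.release i k - S.D j) = S.D i + S.D j by ring] at this

end IsLegal

end TaskSystem.Run

/-! ### Upper integrals, and the sum behind the correction $\Delta$. -/

/-- The upper integral of `f` over `W` is at most `b`. -/
def UpperIntegralLE (W : Set ℝ) (f : ℝ → ℝ) (b : ℝ) : Prop :=
  ∃ g : ℝ → ℝ, IntegrableOn g W ∧ (∀ s ∈ W, f s ≤ g s) ∧ ∫ s in W, g s ≤ b

namespace UpperIntegralLE

variable {W : Set ℝ} {f f' : ℝ → ℝ} {b b' : ℝ}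

theorem mono (h : UpperIntegralLE W f b) (hf : ∀ s ∈ W, f' s ≤ f s) (hb : b ≤ b') :
    UpperIntegralLE W f' b' := by
  obtain ⟨g, h₁, h₂, h₃⟩ := h
  exact ⟨g, h₁, fun s hs => (hf s hs).trans (h₂ s hs), h₃.trans hb⟩

theorem add (h : UpperIntegralLE W f b) (h' : UpperIntegralLE W f' b') :
    UpperIntegralLE W (fun s => f s + f' s) (b + b') := by
  obtain ⟨g, h₁, h₂, h₃⟩ := h
  obtain ⟨g', h₁', h₂', h₃'⟩ := h'
  refine ⟨fun s => g s + g' s, h₁.add h₁', fun s hs => add_le_add (h₂ s hs) (h₂' s hs), ?_⟩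
  rw [integral_add h₁ h₁']
  exact add_le_add h₃ h₃'

theorem const_mul (h : UpperIntegralLE W f b) {c : ℝ} (hc : 0 ≤ c) :
    UpperIntegralLE W (fun s => c * f s) (c * b) := by
  obtain ⟨g, h₁, h₂, h₃⟩ := h
  refine ⟨fun s => c * g s, h₁.const_mul c,
    fun s hs => mul_le_mul_of_nonneg_left (h₂ s hs) hc, ?_⟩
  rw [integral_const_mul]
  exact mul_le_mul_of_nonneg_left h₃ hc

theorem zero : UpperIntegralLE W (fun _ => 0) 0 :=
  ⟨fun _ => 0, integrableOn_zero, fun _ _ => le_rfl, by simp⟩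

theorem sum {α : Type*} (F : Finset α) {f : α → ℝ → ℝ} {b : α → ℝ}
    (h : ∀ a ∈ F, UpperIntegralLE W (f a) (b a)) :
    UpperIntegralLE W (fun s => ∑ a ∈ F, f a s) (∑ a ∈ F, b a) := by
  classical
  induction F using Finset.induction_on with
  | empty => simpa using zero
  | insert a F ha ih =>
    simp only [Finset.sum_insert ha]
    exact (h a (Finset.mem_insert_self _ _)).add
      (ih fun a' ha' => h a' (Finset.mem_insert_of_mem ha'))

theorem indicator {p : ℝ → Prop} [DecidablePred p] (hb : 0 ≤ b)
    (h : volume {s | s ∈ W ∧ p s} ≤ ENNReal.ofReal b) :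
    UpperIntegralLE W (fun s => if p s then 1 else 0) b := by
  -- The measurable hull has the same outer measure, so its indicator is an integrable majorant.
  set M := toMeasurable volume {s | s ∈ W ∧ p s} with hM
  have hMm : MeasurableSet M := measurableSet_toMeasurable _ _
  have hMv : volume M ≤ ENNReal.ofReal b := by rwa [hM, measure_toMeasurable]
  have hMW : volume.restrict W M ≤ ENNReal.ofReal b := (Measure.restrict_apply_le _ _).trans hMv
  refine ⟨M.indicator fun _ => 1, ?_, fun s hs => ?_, ?_⟩
  · exact (integrable_indicator_iff hMm).2 
      (integrableOn_const (hMW.trans_lt ENNReal.ofReal_lt_top).ne)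
  · dsimp only
    split_ifs with hp
    · rw [Set.indicator_of_mem (subset_toMeasurable volume {s | s ∈ W ∧ p s} ⟨hs, hp⟩)]
    · exact Set.indicator_nonneg (fun _ _ => zero_le_one) s
  · rw [integral_indicator hMm, setIntegral_const, smul_eq_mul, mul_one]
    exact ENNReal.toReal_le_of_le_ofReal hb hMW

theorem le_of_forall_le {r t c : ℝ} (hrt : r ≤ t) (h : UpperIntegralLE (Set.Ico r t) f b)
    (hc : ∀ s ∈ Set.Ico r t, c ≤ f s) : c * (t - r) ≤ b := by
  obtain ⟨g, h₁, h₂, h₃⟩ := h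
  refine le_trans ?_ h₃
  have := setIntegral_mono_on (μ := volume) (s := Set.Ico r t) (f := fun _ => c)
    (integrableOn_const (by simp)) h₁ measurableSet_Ico fun s hs => (hc s hs).trans (h₂ s hs)
  rw [setIntegral_const, Real.volume_real_Ico_of_le hrt, smul_eq_mul] at this
  linarith

end UpperIntegralLE

/-- With `c` accesses completed and one being served, at most `N - 1 - c` requests wait, on at most
`m - 1` processors. Summed over `c`, this is the bracket of $\mathcal P^I(0)$. -/
theorem sum_range_min_eq (N m : ℕ) :
    ∑ c ∈ Finset.range N, (min ((m : ℝ) - 1) (N - 1 - c)) =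
      N * ((m : ℝ) - 1) - min (N : ℝ) m * ((m : ℝ) - (min (N : ℝ) m + 1) / 2) := by
  have key : ∀ N : ℕ, ∑ c ∈ Finset.range N, (min ((m : ℝ) - 1) c) =
      N * ((m : ℝ) - 1) - min (N : ℝ) m * ((m : ℝ) - (min (N : ℝ) m + 1) / 2) := by
    intro N
    induction N with
    | zero => simp
    | succ N ih =>
      rw [Finset.sum_range_succ, ih]
      push_cast
      rcases Nat.lt_or_ge N m with hlt | hge
      · have h₁ : (N : ℝ) + 1 ≤ m := by exact_mod_cast hlt
        rw [min_eq_left (by linarith : (N : ℝ) ≤ m), min_eq_left h₁, min_eq_right (by linarith)]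
        ring
      · have h₁ : (m : ℝ) ≤ N := by exact_mod_cast hge
        rw [min_eq_right h₁, min_eq_right (by linarith : (m : ℝ) ≤ N + 1),
          min_eq_left (by linarith)]
        ring
  rw [← key N, ← Finset.sum_range_reflect]
  refine Finset.sum_congr rfl fun c hc => ?_
  have := Finset.mem_range.1 hc
  rw [Nat.cast_sub (by omega), Nat.cast_sub (by omega)]
  congr 1
  simp

/-! ### Processor time charged to contention for a resource. -/

namespace TaskSystem.Run

variable {ι ρ : Type*} {S : TaskSystem ι ρ} {σ : S.Run}

open Classical in
/-- The number of processors of task `i` whose time at `s` is charged to contention for `q`, if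
`P` is the set of vertices of the key path of the `k`-th job. -/
noncomputable def blocking (σ : S.Run) (i : ι) (k : ℕ) (q : ρ) (P : Finset (S.V i)) (s : ℝ) : ℝ :=
  -- While a key-path vertex spins, all processors are charged, except that of a holder of the same
  -- task, which executes. While the key path executes nothing needs charging, and while it is off
  -- the processors, only the spinning ones do.
  if ∃ v ∈ P, σ.Spinning ⟨i, (k, v)⟩ q s then
    if σ.HeldBy q i s then (S.m i : ℝ) - 1 else S.m i
  else if ∃ v ∈ P, σ.OnProc ⟨i, (k, v)⟩ s then 0
  else (Finset.univ.filter fun v => σ.Spinning ⟨i, (k, v)⟩ q s).card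

open Classical in
/-- The number of accesses to `q` that the job has completed. -/
noncomputable def completed (σ : S.Run) (i : ι) (k : ℕ) (q : ρ) (s : ℝ) : ℕ :=
  ((σ.jobRequests i k q Finset.univ).filter fun e =>
    Segment.start (σ.prog ⟨i, (k, e.1)⟩) (e.2 + 1) ≤ σ.work ⟨i, (k, e.1)⟩ s).card

theorem one_le_m (S : TaskSystem ι ρ) (i : ι) : (1 : ℝ) ≤ S.m i := by
  exact_mod_cast S.m_pos i

theorem blocking_nonneg (i : ι) (k : ℕ) (q : ρ) (P : Finset (S.V i)) (s : ℝ) :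
    0 ≤ σ.blocking i k q P s := by
  have := one_le_m S i
  rw [blocking]
  split_ifs <;> linarith

theorem blocking_le_m (i : ι) (k : ℕ) (q : ρ) (P : Finset (S.V i)) (s : ℝ) :
    σ.blocking i k q P s ≤ S.m i := by
  classical
  have := one_le_m S i
  rw [blocking]
  split_ifs
  · linarith
  · exact le_rfl
  · linarith
  · exact_mod_cast card_onProc_le (σ := σ) (k := k) (s := s)
      (Finset.univ.filter fun v => σ.Spinning ⟨i, (k, v)⟩ q s)
      fun v hv => (Finset.mem_filter.1 hv).2.1

namespace IsLegal

variable (h : σ.IsLegal)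
include h

theorem blocking_of_holder_none {i : ι} {k : ℕ} {q : ρ} {P : Finset (S.V i)} {s : ℝ}
    (hs : σ.holder q s = none) : σ.blocking i k q P s = 0 := by
  classical
  have hsp : ∀ v : S.V i, ¬ σ.Spinning ⟨i, (k, v)⟩ q s := fun v hv => h.spinning_held _ q s hv hs
  simp [blocking, hsp]

open Classical in
theorem blocking_le_sum (i : ι) (k : ℕ) (q : ρ) (P : Finset (S.V i)) (s : ℝ) :
    σ.blocking i k q P s ≤ ∑ e ∈ σ.jobRequests i k q Finset.univ,
      (if e.1 ∈ P then (S.m i : ℝ) else 1) *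
        (if σ.SpinRequest ⟨i, (k, e.1)⟩ e.2 q s then 1 else 0) := by
  have hm := one_le_m S i
  have hnn : ∀ e : Σ _ : S.V i, ℕ, 0 ≤ (if e.1 ∈ P then (S.m i : ℝ) else 1) *
      (if σ.SpinRequest ⟨i, (k, e.1)⟩ e.2 q s then 1 else 0) := fun e => by
    split_ifs <;> positivity
  rw [blocking]
  split_ifs with h₁ h₂ h₃
  · obtain ⟨v, hv, hsp⟩ := h₁
    obtain ⟨n, hn⟩ := h.exists_spinRequest hsp
    refine le_trans ?_ (Finset.single_le_sum (fun e _ => hnn e)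
      (mem_jobRequests.2 ⟨Finset.mem_univ v, hn.2.1⟩ : (⟨v, n⟩ : Σ _ : S.V i, ℕ) ∈ _))
    simp [hv, hn]
  · obtain ⟨v, hv, hsp⟩ := h₁
    obtain ⟨n, hn⟩ := h.exists_spinRequest hsp
    refine le_trans ?_ (Finset.single_le_sum (fun e _ => hnn e)
      (mem_jobRequests.2 ⟨Finset.mem_univ v, hn.2.1⟩ : (⟨v, n⟩ : Σ _ : S.V i, ℕ) ∈ _))
    simp [hv, hn]
  · exact Finset.sum_nonneg fun e _ => hnn e
  · rw [jobRequests, Finset.sum_sigma, Finset.card_filter]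
    push_cast
    refine Finset.sum_le_sum fun v _ => ?_
    split_ifs with hv hP hP
    · exact absurd ⟨v, hP, hv⟩ h₁
    · obtain ⟨n, hn⟩ := h.exists_spinRequest hv
      refine le_trans ?_ (Finset.single_le_sum (f := fun n => (1 : ℝ) *
        if σ.SpinRequest ⟨i, (k, v)⟩ n q s then 1 else 0) (fun n _ => ?_) hn.2.1)
      · simp [hn]
      · split_ifs <;> simp
    · exact Finset.sum_nonneg fun n _ => by positivity
    · exact Finset.sum_nonneg fun n _ => by positivity

/-- While the job itself holds `q`, all blocking is due to a vertex outside the key path, and the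
blocked vertices occupy processors other than that of the holder. -/
theorem blocking_le_of_held {t : ℝ} (hmet : σ.MeetsDeadlinesBefore t) {i : ι} {k : ℕ}
    (ht : t ≤ σ.release i k + S.D i) {s : ℝ} (hs : s ∈ Set.Ico (σ.release i k) t) {q : ρ}
    {P : Finset (S.V i)}
    (huniq : ∀ v ∈ P, ∀ w ∈ P, σ.OnProc ⟨i, (k, v)⟩ s → σ.OnProc ⟨i, (k, w)⟩ s → v = w)
    (hheld : σ.HeldBy q i s) :
    σ.blocking i k q P s = 0 ∨
      σ.blocking i k q P s ≤ S.m i - 1 ∧ ∃ v ∉ P, σ.holder q s = some ⟨i, (k, v)⟩ := by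
  classical
  have hm := one_le_m S i
  obtain ⟨⟨i', k', v₀⟩, hv₀, rfl⟩ := id hheld
  have hon := (h.holder_access q _ s hv₀).1
  obtain rfl : k' = k := h.job_eq hmet ht hs hon rfl
  rw [blocking]
  split_ifs with h₁ h₂
  · obtain ⟨v, hv, hsp⟩ := h₁
    refine Or.inr ⟨le_rfl, v₀, fun hmem => ?_, hv₀⟩
    rw [huniq v hv v₀ hmem hsp.1 hon] at hsp
    exact hsp.2.2 hv₀
  · exact Or.inl rfl
  · refine Or.inr ⟨?_, v₀, fun hmem => h₂ ⟨v₀, hmem, hon⟩, hv₀⟩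
    have hnot : v₀ ∉ Finset.univ.filter fun v => σ.Spinning ⟨i', (k', v)⟩ q s := fun hmem =>
      (Finset.mem_filter.1 hmem).2.2.2 hv₀
    have := card_onProc_le (σ := σ) (k := k') (s := s) (insert v₀ (Finset.univ.filter fun v =>
      σ.Spinning ⟨i', (k', v)⟩ q s)) fun v hv => by
        rcases Finset.mem_insert.1 hv with rfl | hv
        · exact hon
        · exact (Finset.mem_filter.1 hv).2.1
    rw [Finset.card_insert_of_notMem hnot] at this
    rw [le_sub_iff_add_le]
    exact_mod_cast this

/-- If the key path does not access `q`, then the requests blocked by an access of the job are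
those that are neither completed nor being served. -/
theorem blocking_add_completed_lt {t : ℝ} (hmet : σ.MeetsDeadlinesBefore t) {i : ι} {k : ℕ}
    (ht : t ≤ σ.release i k + S.D i) {s : ℝ} (hs : s ∈ Set.Ico (σ.release i k) t) {q : ρ}
    {P : Finset (S.V i)} (hP : σ.jobRequests i k q P = ∅) (hheld : σ.HeldBy q i s) :
    σ.blocking i k q P s + σ.completed i k q s + 1 ≤ S.N i q := by
  classical
  obtain ⟨⟨i', k', v₀⟩, hv₀, rfl⟩ := id hheld
  have hon := (h.holder_access q _ s hv₀).1
  obtain rfl : k' = k := h.job_eq hmet ht hs hon rfl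
  obtain ⟨n₀, hn₀⟩ := h.exists_holder_request hv₀
  set Sp := Finset.univ.filter fun v => σ.Spinning ⟨i', (k', v)⟩ q s with hSp
  have hble : σ.blocking i' k' q P s ≤ Sp.card := by
    rw [blocking]
    have h₁ : ¬ ∃ v ∈ P, σ.Spinning ⟨i', (k', v)⟩ q s := by
      rintro ⟨v, hv, hsp⟩
      obtain ⟨n, hn⟩ := h.exists_spinRequest hsp
      have : (⟨v, n⟩ : Σ _ : S.V i', ℕ) ∈ σ.jobRequests i' k' q P :=
        mem_jobRequests.2 ⟨hv, hn.2.1⟩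
      simp [hP] at this
    rw [if_neg h₁]
    split_ifs
    · positivity
    · exact le_rfl
  have hex : ∀ v ∈ Sp, ∃ n, σ.SpinRequest ⟨i', (k', v)⟩ n q s := fun v hv =>
    h.exists_spinRequest (Finset.mem_filter.1 hv).2
  choose! f hf using hex
  set C := (σ.jobRequests i' k' q Finset.univ).filter fun e =>
    Segment.start (σ.prog ⟨i', (k', e.1)⟩) (e.2 + 1) ≤ σ.work ⟨i', (k', e.1)⟩ s with hC
  set Q := Sp.map ⟨fun v => (⟨v, f v⟩ : Σ _ : S.V i', ℕ), fun v w e => congrArg Sigma.fst e⟩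
    with hQ
  have hQmem : ∀ e ∈ Q, e.1 ∈ Sp ∧ σ.SpinRequest ⟨i', (k', e.1)⟩ e.2 q s := by
    intro e he
    obtain ⟨v, hv, rfl⟩ := Finset.mem_map.1 he
    exact ⟨hv, hf v hv⟩
  have hdisj : Disjoint Q C := by
    rw [Finset.disjoint_left]
    intro e he heC
    exact absurd (Finset.mem_filter.1 heC).2 (not_le.2 (hQmem e he).2.2.2.2)
  have hnot : (⟨v₀, n₀⟩ : Σ _ : S.V i', ℕ) ∉ Q ∪ C := by
    intro hmem
    rcases Finset.mem_union.1 hmem with he | he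
    · exact (hQmem _ he).2.1.2.2 hv₀
    · exact absurd (Finset.mem_filter.1 he).2 (not_le.2 hn₀.2.2)
  -- The served access, the spinning requests `Q` and the completed accesses `C` are disjoint sets
  -- among at most $N_{i,q}$ accesses.
  have hsub : insert (⟨v₀, n₀⟩ : Σ _ : S.V i', ℕ) (Q ∪ C) ⊆
      σ.jobRequests i' k' q Finset.univ := by
    intro e he
    rcases Finset.mem_insert.1 he with rfl | he
    · exact mem_jobRequests.2 ⟨Finset.mem_univ _, hn₀.1⟩
    rcases Finset.mem_union.1 he with he | he
    · exact mem_jobRequests.2 ⟨Finset.mem_univ _, (hQmem e he).2.2.1⟩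
    · exact (Finset.mem_filter.1 he).1
  have hcard := (Finset.card_le_card hsub).trans (h.card_jobRequests_le i' k' q _)
  rw [Finset.card_insert_of_notMem hnot, Finset.card_union_of_disjoint hdisj, hQ,
    Finset.card_map] at hcard
  have : (Sp.card : ℝ) + σ.completed i' k' q s + 1 ≤ S.N i' q := by exact_mod_cast hcard
  simp only
  linarith

/-- A single access of the job is served while a given number of accesses is completed. -/
theorem volume_completed_le {t : ℝ} (hmet : σ.MeetsDeadlinesBefore t) {i : ι} {k : ℕ}
    (ht : t ≤ σ.release i k + S.D i) (q : ρ) (c : ℕ) :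
    volume {s | s ∈ Set.Ico (σ.release i k) t ∧ σ.HeldBy q i s ∧ σ.completed i k q s = c} ≤
      ENNReal.ofReal (S.L i q) := by
  classical
  have hhold : ∀ s ∈ Set.Ico (σ.release i k) t, σ.HeldBy q i s →
      ∃ v n, σ.holder q s = some ⟨i, (k, v)⟩ ∧ σ.AtRequest ⟨i, (k, v)⟩ n q s := by
    rintro s hs ⟨⟨i', k', v₀⟩, hv₀, rfl⟩
    obtain rfl : k' = k := h.job_eq hmet ht hs (h.holder_access q _ s hv₀).1 rfl
    obtain ⟨n₀, hn₀⟩ := h.exists_holder_request hv₀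
    exact ⟨v₀, n₀, hv₀, hn₀⟩
  have hsame : ∀ s s' v n v' n', s ≤ s' → σ.completed i k q s = σ.completed i k q s' →
      σ.holder q s = some ⟨i, (k, v)⟩ → σ.AtRequest ⟨i, (k, v)⟩ n q s →
      σ.holder q s' = some ⟨i, (k, v')⟩ → σ.AtRequest ⟨i, (k, v')⟩ n' q s' →
      v = v' ∧ n = n' := by
    intro s s' v n v' n' hss hc hv hn hv' hn'
    by_cases hlt : σ.work ⟨i, (k, v)⟩ s' < Segment.start (σ.prog ⟨i, (k, v)⟩) (n + 1)
    · have hkeep := h.holder_keeps q _ s s' hv hss ((h.sameSegment_iff hn).2 hlt)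
      rw [hv'] at hkeep
      obtain rfl : v' = v := by simpa using hkeep
      exact ⟨rfl, h.atRequest_unique (h.atRequest_of_le hn hss hlt) hn'⟩
    -- Otherwise the access served at `s` is complete at `s'`, which strictly increases the number
    -- of completed accesses.
    · exfalso
      refine hc.not_lt (Finset.card_lt_card ((Finset.ssubset_iff_of_subset ?_).2
        ⟨⟨v, n⟩, ?_, ?_⟩))
      · intro e he
        obtain ⟨h₁, h₂⟩ := Finset.mem_filter.1 he
        exact Finset.mem_filter.2 ⟨h₁, h₂.trans (h.work_mono _ hss)⟩
      · exact Finset.mem_filter.2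
          ⟨mem_jobRequests.2 ⟨Finset.mem_univ _, hn.1⟩, not_lt.1 hlt⟩
      · exact fun he => absurd (Finset.mem_filter.1 he).2 (not_le.2 hn.2.2)
  rcases Set.eq_empty_or_nonempty {s | s ∈ Set.Ico (σ.release i k) t ∧ σ.HeldBy q i s ∧
    σ.completed i k q s = c} with he | ⟨s₀, hs₀, hheld₀, hc₀⟩
  · rw [he]; simp
  obtain ⟨v₀, n₀, hv₀, hn₀⟩ := hhold s₀ hs₀ hheld₀
  have := h.volume_le_of_holder (q := q) (A := {s | s ∈ Set.Ico (σ.release i k) t ∧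
      σ.HeldBy q i s ∧ σ.completed i k q s = c}) (C := S.L i q) (K := 1) {()}
    (fun _ => ⟨i, (k, v₀)⟩) (fun _ => n₀) (fun s hs => Set.Ico_subset_Icc_self hs.1)
    (fun _ _ => le_rfl) ?_ (S.L i q).2 (by simp)
  · simpa using this
  rintro s ⟨hs, hheld, hc⟩
  obtain ⟨v, n, hv, hn⟩ := hhold s hs hheld
  refine ⟨(), by simp, ?_⟩
  rcases le_total s s₀ with hle | hle
  · obtain ⟨rfl, rfl⟩ := hsame s s₀ v n v₀ n₀ hle (hc.trans hc₀.symm) hv hn hv₀ hn₀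
    exact ⟨hv, hn⟩
  · obtain ⟨rfl, rfl⟩ := hsame s₀ s v₀ n₀ v n hle (hc₀.trans hc.symm) hv₀ hn₀ hv hn
    exact ⟨hv, hn⟩

end IsLegal

end TaskSystem.Run

/-! ### Integrated blocking, split by the task holding the lock. -/

namespace TaskSystem.Run

variable {ι ρ : Type*} {S : TaskSystem ι ρ} {σ : S.Run}

namespace IsLegal

variable (h : σ.IsLegal)
include h

open Classical in
theorem upperIntegralLE_own {t : ℝ} (hmet : σ.MeetsDeadlinesBefore t) {i : ι} {k : ℕ}
    (ht : t ≤ σ.release i k + S.D i) {P : Finset (S.V i)}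
    (huniq : ∀ s, ∀ v ∈ P, ∀ w ∈ P, σ.OnProc ⟨i, (k, v)⟩ s → σ.OnProc ⟨i, (k, w)⟩ s → v = w)
    (q : ρ) :
    UpperIntegralLE (Set.Ico (σ.release i k) t)
      (fun s => if σ.HeldBy q i s then σ.blocking i k q P s else 0)
      (S.intraTerm i q (σ.jobRequests i k q P).card) := by
  have hm := one_le_m S i
  rcases (σ.jobRequests i k q P).eq_empty_or_nonempty with hP | hP
  -- For `x = 0`, times are sorted by the number `c` of completed accesses; each class is served by
  -- a single access.
  · have hsum := UpperIntegralLE.sum (W := Set.Ico (σ.release i k) t) (Finset.range (S.N i q))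
      (f := fun c s => min ((S.m i : ℝ) - 1) (S.N i q - 1 - c) *
        (if σ.HeldBy q i s ∧ σ.completed i k q s = c then 1 else 0))
      (b := fun c => min ((S.m i : ℝ) - 1) (S.N i q - 1 - c) * S.L i q) fun c hc => by
        refine (UpperIntegralLE.indicator (S.L i q).2
          (h.volume_completed_le hmet ht q c)).const_mul ?_
        have : (c : ℝ) + 1 ≤ S.N i q := by exact_mod_cast Finset.mem_range.1 hc
        exact le_min (by linarith) (by linarith)
    refine hsum.mono (fun s hs => ?_) (le_of_eq ?_)
    · have hnn : ∀ c ∈ Finset.range (S.N i q), 0 ≤ min ((S.m i : ℝ) - 1) (S.N i q - 1 - c) *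
          (if σ.HeldBy q i s ∧ σ.completed i k q s = c then (1 : ℝ) else 0) := by
        intro c hc
        have : (c : ℝ) + 1 ≤ S.N i q := by exact_mod_cast Finset.mem_range.1 hc
        refine mul_nonneg (le_min (by linarith) (by linarith)) ?_
        split_ifs <;> simp
      split_ifs with hheld
      · have hlt := h.blocking_add_completed_lt hmet ht hs hP hheld
        have hb : σ.blocking i k q P s ≤ S.m i - 1 := by
          rcases h.blocking_le_of_held hmet ht hs (huniq s) hheld with h₀ | h₀
          · linarith
          · exact h₀.1
        have hmem : σ.completed i k q s ∈ Finset.range (S.N i q) := by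
          have h₀ := blocking_nonneg (σ := σ) i k q P s
          have : (σ.completed i k q s : ℝ) + 1 ≤ S.N i q := by linarith
          exact Finset.mem_range.2 (by exact_mod_cast this)
        refine le_trans ?_ (Finset.single_le_sum hnn hmem)
        simp only [hheld, and_self, if_true, mul_one]
        exact le_min hb (by linarith)
      · exact Finset.sum_nonneg hnn
    · rw [← Finset.sum_mul, sum_range_min_eq, hP]
      simp [intraTerm]
  -- For `x ≥ 1` the correction vanishes, and each of the at most `N - x` accesses off the path
  -- blocks at most `m - 1` processors.
  · have hx : 1 ≤ (σ.jobRequests i k q P).card := hP.card_pos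
    have hcard : (σ.jobRequests i k q (Finset.univ \ P)).card + (σ.jobRequests i k q P).card ≤
        S.N i q := by
      rw [card_jobRequests, card_jobRequests, Finset.sum_sdiff (Finset.subset_univ P)]
      exact h.accesses_le i k q
    have hcard' : ((σ.jobRequests i k q (Finset.univ \ P)).card : ℝ) ≤
        (S.N i q : ℝ) - (σ.jobRequests i k q P).card := by
      rw [le_sub_iff_add_le]; exact_mod_cast hcard
    have hvol := h.volume_le_of_holder (q := q) (A := {s | s ∈ Set.Ico (σ.release i k) t ∧
        ∃ v ∉ P, σ.holder q s = some ⟨i, (k, v)⟩}) (C := S.L i q)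
      (σ.jobRequests i k q (Finset.univ \ P)) (fun e => ⟨i, (k, e.1)⟩) (fun e => e.2)
      (fun s hs => Set.Ico_subset_Icc_self hs.1) (fun _ _ => le_rfl) (by
        rintro s ⟨-, v, hv, hhold⟩
        obtain ⟨n, hn⟩ := h.exists_holder_request hhold
        exact ⟨⟨v, n⟩, mem_jobRequests.2 ⟨by simpa using hv, hn.1⟩, hhold, hn⟩) (S.L i q).2 hcard'
    have hnn : 0 ≤ ((S.N i q : ℝ) - (σ.jobRequests i k q P).card) * S.L i q :=
      mul_nonneg (le_trans (by positivity) hcard') (S.L i q).2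
    refine ((UpperIntegralLE.indicator hnn hvol).const_mul
      (c := (S.m i : ℝ) - 1) (by linarith)).mono (fun s hs => ?_) (le_of_eq ?_)
    · have hz : (0 : ℝ) ≤ ((S.m i : ℝ) - 1) *
          if ∃ v ∉ P, σ.holder q s = some ⟨i, (k, v)⟩ then 1 else 0 :=
        mul_nonneg (by linarith) (by split_ifs <;> simp)
      split_ifs with hheld hex
      · rcases h.blocking_le_of_held hmet ht hs (huniq s) hheld with h₀ | h₀
        · rw [h₀]; linarith
        · linarith [h₀.1]
      · rcases h.blocking_le_of_held hmet ht hs (huniq s) hheld with h₀ | h₀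
        · rw [h₀]; linarith
        · exact absurd h₀.2 hex
      · linarith
      · linarith
    · have hx' : (1 : ℝ) ≤ (σ.jobRequests i k q P).card := by exact_mod_cast hx
      simp only [intraTerm]
      rw [max_eq_right (by linarith)]
      ring

open Classical in
theorem sum_weight_le (i : ι) (k : ℕ) (q : ρ) (P : Finset (S.V i)) :
    ∑ e ∈ σ.jobRequests i k q Finset.univ, (if e.1 ∈ P then (S.m i : ℝ) else 1) ≤
      S.N i q + ((S.m i : ℝ) - 1) * (σ.jobRequests i k q P).card := by
  have hfilter : (σ.jobRequests i k q Finset.univ).filter (fun e => e.1 ∈ P) =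
      σ.jobRequests i k q P := by
    ext e
    simp [mem_jobRequests, and_comm]
  have hN : ((σ.jobRequests i k q Finset.univ).card : ℝ) ≤ S.N i q := by
    exact_mod_cast h.card_jobRequests_le i k q _
  have : ∀ e : Σ _ : S.V i, ℕ, (if e.1 ∈ P then (S.m i : ℝ) else 1) =
      1 + ((S.m i : ℝ) - 1) * (if e.1 ∈ P then 1 else 0) := fun e => by split_ifs <;> ring
  simp only [this]
  rw [Finset.sum_add_distrib, ← Finset.mul_sum, Finset.sum_boole, hfilter, Finset.sum_const,
    nsmul_eq_mul, mul_one]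
  linarith

open Classical in
theorem upperIntegralLE_of_request {t : ℝ} {i : ι} {k : ℕ} {P : Finset (S.V i)} {q : ρ}
    {p : ℝ → Prop} [DecidablePred p] {b : ℝ} (hb : 0 ≤ b)
    (hvol : ∀ w n, volume {s | s ∈ Set.Ico (σ.release i k) t ∧
      σ.SpinRequest ⟨i, (k, w)⟩ n q s ∧ p s} ≤ ENNReal.ofReal b) :
    UpperIntegralLE (Set.Ico (σ.release i k) t)
      (fun s => if p s then σ.blocking i k q P s else 0)
      ((S.N i q + ((S.m i : ℝ) - 1) * (σ.jobRequests i k q P).card) * b) := by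
  have hw : ∀ e : Σ _ : S.V i, ℕ, 0 ≤ (if e.1 ∈ P then (S.m i : ℝ) else 1) := fun e => by
    split_ifs <;> positivity
  refine (UpperIntegralLE.sum (σ.jobRequests i k q Finset.univ) fun e _ =>
    (UpperIntegralLE.indicator hb (hvol e.1 e.2)).const_mul (hw e)).mono (fun s _ => ?_) ?_
  · split_ifs with hp
    · simpa only [hp, and_true] using h.blocking_le_sum i k q P s
    · simp [hp]
  · rw [← Finset.sum_mul]
    exact mul_le_mul_of_nonneg_right (h.sum_weight_le i k q P) hb

variable [Fintype ι]

open Classical in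
theorem upperIntegralLE_lower (hprio : σ.PriorityOrdered) {t : ℝ} {i : ι} {k : ℕ}
    (P : Finset (S.V i)) (q : ρ) :
    UpperIntegralLE (Set.Ico (σ.release i k) t)
      (fun s => if ∃ j ∈ S.lower i, σ.HeldBy q j s then σ.blocking i k q P s else 0)
      (S.lowerTerm i q (σ.jobRequests i k q P).card) := by
  refine h.upperIntegralLE_of_request (S.maxLower i q).2 fun w n => ?_
  have := h.volume_lower_le hprio (x := ⟨i, (k, w)⟩) (n := n) (q := q)
    (A := {s | s ∈ Set.Ico (σ.release i k) t ∧ σ.SpinRequest ⟨i, (k, w)⟩ n q s})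
    (fun s hs => Set.Ico_subset_Icc_self hs.1) fun s hs => hs.2
  refine le_trans (measure_mono ?_) this
  rintro s ⟨h₁, h₂, h₃⟩
  exact ⟨⟨h₁, h₂⟩, h₃⟩

open Classical in
theorem upperIntegralLE_higher (hprio : σ.PriorityOrdered) {tie : TieBreak}
    (htie : σ.RespectsTies tie) {t : ℝ} (hmet : σ.MeetsDeadlinesBefore t) {i : ι} {k : ℕ}
    (ht : t ≤ σ.release i k + S.D i) (P : Finset (S.V i)) {q : ρ} (hN : 0 < S.N i q) (j : ι) :
    UpperIntegralLE (Set.Ico (σ.release i k) t)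
      (fun s => if σ.HeldBy q j s then σ.blocking i k q P s else 0)
      (((min ((S.m i * S.eta i j q * S.N j q : ℕ) : ℕ∞)
        (((S.N i q + (S.m i - 1) * (σ.jobRequests i k q P).card : ℕ) : ℕ∞) *
          S.jobsPerRequest tie i j q * S.N j q)).toNat : ℝ) * S.L j q) := by
  have hwindow : UpperIntegralLE (Set.Ico (σ.release i k) t)
      (fun s => if σ.HeldBy q j s then σ.blocking i k q P s else 0)
      (S.m i * ((⌈(S.D i + S.D j) / S.T j⌉₊ : ℝ) * S.N j q * S.L j q)) := by
    refine ((UpperIntegralLE.indicator (by positivity)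
      (h.volume_window_le hmet ht (q := q) j)).const_mul (Nat.cast_nonneg _)).mono
      (fun s _ => ?_) le_rfl
    split_ifs
    · rw [mul_one]; exact blocking_le_m i k q P s
    · simp
  rcases Nat.eq_zero_or_pos (S.N j q) with hNj | hNj
  · refine hwindow.mono (fun _ _ => le_rfl) ?_
    simp [hNj]
  -- Without a fixed point the second argument of the minimum must be `⊤`, which needs nonzero
  -- factors because `0 * ⊤ = 0`.
  have hpos : 0 < S.N i q + (S.m i - 1) * (σ.jobRequests i k q P).card := by omega
  rw [eta, jobsPerRequest, if_pos ⟨hN, hNj⟩, if_pos ⟨hN, hNj⟩]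
  split_ifs with hd
  · have hmin : ∀ a b : ℕ, (min (a : ℕ∞) b).toNat = min a b := fun a b => by
      rcases le_total a b with hab | hab
      · rw [min_eq_left hab, min_eq_left (by exact_mod_cast hab), ENat.toNat_natCast]
      · rw [min_eq_right hab, min_eq_right (by exact_mod_cast hab), ENat.toNat_natCast]
    rw [← Nat.cast_mul, ← Nat.cast_mul, hmin]
    rcases min_choice (S.m i * ⌈(S.D i + S.D j) / S.T j⌉₊ * S.N j q)
      ((S.N i q + (S.m i - 1) * (σ.jobRequests i k q P).card) *
        ⌈(S.dpr tie i q + S.D j) / S.T j⌉₊ * S.N j q) with he | he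
    · rw [he]
      refine hwindow.mono (fun _ _ => le_rfl) (le_of_eq ?_)
      push_cast
      ring
    · rw [he]
      refine (h.upperIntegralLE_of_request (P := P) (by positivity) fun w n =>
        h.volume_higher_le hprio htie hmet ht (w := w) (n := n) j hd).mono
        (fun _ _ => le_rfl) (le_of_eq ?_)
      push_cast [Nat.cast_sub (show 1 ≤ S.m i from S.m_pos i)]
      ring
  · rw [ENat.mul_top (by exact_mod_cast hpos.ne'), ENat.top_mul (by exact_mod_cast hNj.ne'),
      min_eq_left le_top, ENat.toNat_natCast]
    refine hwindow.mono (fun _ _ => le_rfl) (le_of_eq ?_)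
    push_cast
    ring

theorem upperIntegralLE_blocking (hprio : σ.PriorityOrdered) {tie : TieBreak}
    (htie : σ.RespectsTies tie) {t : ℝ} (hmet : σ.MeetsDeadlinesBefore t) {i : ι} {k : ℕ}
    (ht : t ≤ σ.release i k + S.D i) {P : Finset (S.V i)}
    (huniq : ∀ s, ∀ v ∈ P, ∀ w ∈ P, σ.OnProc ⟨i, (k, v)⟩ s → σ.OnProc ⟨i, (k, w)⟩ s → v = w)
    {q : ρ} (hN : 0 < S.N i q) :
    UpperIntegralLE (Set.Ico (σ.release i k) t) (σ.blocking i k q P)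
      (S.intraTerm i q (σ.jobRequests i k q P).card +
        (S.lowerTerm i q (σ.jobRequests i k q P).card +
          S.higherTerm tie i q (σ.jobRequests i k q P).card)) := by
  classical
  refine ((h.upperIntegralLE_own hmet ht huniq q).add ((h.upperIntegralLE_lower hprio P q).add
    (UpperIntegralLE.sum (S.higher i) fun j _ =>
      h.upperIntegralLE_higher hprio htie hmet ht P hN j))).mono (fun s _ => ?_) le_rfl
  have hb := blocking_nonneg (σ := σ) i k q P s
  have hite : ∀ (p : Prop) [Decidable p], 0 ≤ if p then σ.blocking i k q P s else 0 := fun p _ => by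
    split_ifs <;> linarith
  have h₁ := hite (σ.HeldBy q i s)
  have h₂ := hite (∃ j ∈ S.lower i, σ.HeldBy q j s)
  have h₃ : 0 ≤ ∑ j ∈ S.higher i, if σ.HeldBy q j s then σ.blocking i k q P s else 0 :=
    Finset.sum_nonneg fun j _ => hite _
  rcases hz : σ.holder q s with _ | z
  · rw [h.blocking_of_holder_none hz] at h₁ h₂ h₃ ⊢
    linarith
  rcases lt_trichotomy (S.prio z.1) (S.prio i) with hlt | heq | hlt
  · have hl : ∃ j ∈ S.lower i, σ.HeldBy q j s := ⟨z.1, by simpa [lower] using hlt, z, hz, rfl⟩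
    simp only [if_pos hl] at h₂ ⊢
    linarith
  · have ho : σ.HeldBy q i s := ⟨z, hz, S.prio_injective heq⟩
    simp only [if_pos ho] at h₁ ⊢
    linarith
  · have hj : z.1 ∈ S.higher i := by simpa [higher] using hlt
    have := Finset.single_le_sum (f := fun j => if σ.HeldBy q j s then σ.blocking i k q P s else 0)
      (fun j _ => hite _) hj
    simp only [if_pos (show σ.HeldBy q z.1 s from ⟨z, hz, rfl⟩)] at this
    linarith

end IsLegal

end TaskSystem.Run

/-! ### The key path and the accounting of all processors. -/

namespace TaskSystem

variable {ι ρ : Type*} {S : TaskSystem ι ρ}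

theorem pairwise_of_isChain {i : ι} {l : List (S.V i)} (hl : l.IsChain (S.E i)) :
    l.Pairwise (Relation.TransGen (S.E i)) :=
  List.isChain_iff_pairwise.1 (hl.imp fun _ _ => Relation.TransGen.single)

theorem nodup_of_isChain {i : ι} {l : List (S.V i)} (hl : l.IsChain (S.E i)) : l.Nodup :=
  (pairwise_of_isChain hl).imp fun {a b} hab (he : a = b) => S.acyclic i a (by rwa [← he] at hab)

theorem sum_le_longestPath {i : ι} {l : List (S.V i)} (hl : l.IsChain (S.E i)) :
    (l.map fun v => (S.c i v : ℝ)).sum ≤ S.longestPath i := by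
  classical
  refine le_csSup ⟨S.totalWCET i, ?_⟩ ⟨l, hl, rfl⟩
  rintro _ ⟨π, hπ, rfl⟩
  rw [← List.sum_toFinset _ (nodup_of_isChain hπ), totalWCET]
  exact Finset.sum_le_sum_of_subset_of_nonneg (Finset.subset_univ _) fun v _ _ => (S.c i v).2

namespace Run

variable {σ : S.Run}

namespace IsLegal

variable (h : σ.IsLegal)
include h

theorem finished_mono {i : ι} {k : ℕ} {v : S.V i} {t t' : ℝ} (ht : t ≤ t')
    (hv : σ.Finished i k v t) : σ.Finished i k v t' :=
  ⟨hv.1.trans ht, fun u hu => (hv.2 u hu).trans (h.work_mono _ ht)⟩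

theorem work_le_total (x : S.Inst) (t : ℝ) : σ.work x t ≤ Segment.total (σ.prog x) := by
  have hnn : 0 ≤ Segment.total (σ.prog x) :=
    List.sum_nonneg fun a ha => by
      obtain ⟨s, hs, rfl⟩ := List.mem_map.1 ha
      exact (h.len_pos x s hs).le
  have := h.volume_le_of_work_mem (x := x) (A := {s | s < t ∧ σ.Executing x s}) (a := 0)
    (b := Segment.total (σ.prog x))
    ((h.executing_subset x t).trans Set.Ico_subset_Icc_self) (fun s hs => hs.2)
    fun s hs => ⟨h.work_nonneg x s, (h.eligible_and_work_lt hs.2.1).2.le⟩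
  rw [sub_zero] at this
  rw [h.work_eq]
  exact ENNReal.toReal_le_of_le_ofReal hnn this

/-- A path to `v` that contains, at each time in `A`, an eligible unfinished vertex. -/
theorem exists_keyPath {i : ι} {k : ℕ} (v : S.V i) (A : Set ℝ)
    (hA : ∀ s ∈ A, σ.release i k ≤ s ∧ ¬ σ.Finished i k v s) :
    ∃ l : List (S.V i), (v :: l).IsChain (fun a b => S.E i b a) ∧
      ∀ s ∈ A, ∃ w ∈ v :: l, σ.Eligible i k w s ∧ ¬ σ.Finished i k w s := by
  have hirr : Std.Irrefl (Relation.TransGen (S.E i)) := ⟨S.acyclic i⟩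
  have hwf : WellFounded (Relation.TransGen (S.E i)) :=
    Finite.wellFounded_of_trans_of_irrefl _
  induction v using hwf.induction generalizing A with
  | _ v ih =>
    by_cases hall : ∀ s ∈ A, ∀ u, S.E i u v → σ.Finished i k u s
    · exact ⟨[], by simp, fun s hs =>
        ⟨v, by simp, ⟨(hA s hs).1, hall s hs⟩, (hA s hs).2⟩⟩
    push Not at hall
    obtain ⟨s₀, hs₀, u₀, hu₀, -⟩ := hall
    -- The sets of times at which the predecessors are unfinished are initial segments of `A`, hence
    -- nested. A maximal one contains all others: `u` is a predecessor that finishes last.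
    obtain ⟨u, hu, hmax⟩ := Set.Finite.exists_maximalFor
      (fun u => {s | s ∈ A ∧ ¬ σ.Finished i k u s}) {u | S.E i u v} (Set.toFinite _) ⟨u₀, hu₀⟩
    have htop : ∀ s ∈ A, ∀ u', S.E i u' v → ¬ σ.Finished i k u' s → ¬ σ.Finished i k u s := by
      intro s hs u' hu' hns hfin
      have hle : {s | s ∈ A ∧ ¬ σ.Finished i k u s} ⊆ {s | s ∈ A ∧ ¬ σ.Finished i k u' s} := by
        rintro s' ⟨hs', hns'⟩
        refine ⟨hs', fun hfin' => ?_⟩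
        rcases le_total s s' with hle | hle
        · exact hns' (h.finished_mono hle hfin)
        · exact hns (h.finished_mono hle hfin')
      exact (hmax hu' hle ⟨hs, hns⟩).2 hfin
    obtain ⟨l, hl, hkey⟩ := ih u (.single hu) {s | s ∈ A ∧ ¬ σ.Finished i k u s}
      fun s hs => ⟨(hA s hs.1).1, hs.2⟩
    refine ⟨u :: l, List.isChain_cons_cons.2 ⟨hu, hl⟩, fun s hs => ?_⟩
    by_cases hfin : σ.Finished i k u s
    · exact ⟨v, by simp, ⟨(hA s hs).1, fun u' hu' => by
        by_contra hns
        exact htop s hs u' hu' hns hfin⟩, (hA s hs).2⟩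
    · obtain ⟨w, hw, hw'⟩ := hkey s ⟨hs, hfin⟩
      exact ⟨w, List.mem_cons_of_mem _ hw, hw'⟩

theorem not_transGen_of_onProc {i : ι} {k : ℕ} {v w : S.V i} {s : ℝ}
    (hv : σ.OnProc ⟨i, (k, v)⟩ s) (hw : σ.OnProc ⟨i, (k, w)⟩ s) :
    ¬ Relation.TransGen (S.E i) v w := by
  intro hvw
  obtain ⟨u, hu, huw⟩ := Relation.TransGen.tail'_iff.1 hvw
  exact absurd (((h.eligible_and_work_lt hw).1.2 u huw).2 v hu)
    (not_le.2 (h.eligible_and_work_lt hv).2)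

/-- Vertices of a path are comparable, and a vertex is not eligible before its ancestors have
finished. -/
theorem eq_of_onProc_of_isChain {i : ι} {k : ℕ} {l : List (S.V i)} (hl : l.IsChain (S.E i))
    {v w : S.V i} (hv : v ∈ l) (hw : w ∈ l) {s : ℝ} (hv' : σ.OnProc ⟨i, (k, v)⟩ s)
    (hw' : σ.OnProc ⟨i, (k, w)⟩ s) : v = w := by
  by_contra hne
  have : Std.Symm fun a b : S.V i =>
      Relation.TransGen (S.E i) a b ∨ Relation.TransGen (S.E i) b a := ⟨fun _ _ => Or.symm⟩
  rcases ((pairwise_of_isChain hl).imp fun {a b} hab => (Or.inl hab :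
    Relation.TransGen (S.E i) a b ∨ Relation.TransGen (S.E i) b a)).forall hv hw hne with hvw | hvw
  · exact h.not_transGen_of_onProc hv' hw' hvw
  · exact h.not_transGen_of_onProc hw' hv' hvw

variable [Fintype ι] [Fintype ρ]

omit [Fintype ι] in
theorem mem_resources_of_spinning {i : ι} {k : ℕ} {v : S.V i} {q : ρ} {s : ℝ}
    (hv : σ.Spinning ⟨i, (k, v)⟩ q s) : q ∈ S.resources i := by
  obtain ⟨n, hn⟩ := h.exists_spinRequest hv
  have hmem : (⟨v, n⟩ : Σ _ : S.V i, ℕ) ∈ σ.jobRequests i k q Finset.univ :=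
    mem_jobRequests.2 ⟨Finset.mem_univ _, hn.2.1⟩
  simpa [resources] using
    (Finset.card_pos.2 ⟨_, hmem⟩).trans_le (h.card_jobRequests_le i k q Finset.univ)

open Classical in
omit [Fintype ι] in
/-- At each time all processors are accounted for by the execution of the job, by the execution
of its key path, and by blocking. -/
theorem m_le_executing_add_blocking {t : ℝ} (hmet : σ.MeetsDeadlinesBefore t) {i : ι} {k : ℕ}
    (ht : t ≤ σ.release i k + S.D i) {P : Finset (S.V i)} {s : ℝ}
    (hs : s ∈ Set.Ico (σ.release i k) t)
    (hkey : ∃ w ∈ P, σ.Eligible i k w s ∧ ¬ σ.Finished i k w s) :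
    (S.m i : ℝ) ≤ ∑ v, (if σ.Executing ⟨i, (k, v)⟩ s then 1 else 0) +
      (((S.m i : ℝ) - 1) * ∑ v ∈ P, (if σ.Executing ⟨i, (k, v)⟩ s then 1 else 0) +
        ∑ q ∈ S.resources i, σ.blocking i k q P s) := by
  have hm := one_le_m S i
  have hone : ∀ (F : Finset (S.V i)) (v : S.V i), v ∈ F → σ.Executing ⟨i, (k, v)⟩ s →
      (1 : ℝ) ≤ ∑ v ∈ F, (if σ.Executing ⟨i, (k, v)⟩ s then 1 else 0) := by
    intro F v hv hex
    have := Finset.single_le_sum (s := F)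
      (f := fun v => if σ.Executing ⟨i, (k, v)⟩ s then (1 : ℝ) else 0)
      (fun v _ => by split_ifs <;> simp) hv
    simpa [hex] using this
  have hnn : ∀ F : Finset (S.V i),
      (0 : ℝ) ≤ ∑ v ∈ F, (if σ.Executing ⟨i, (k, v)⟩ s then 1 else 0) := fun F =>
    Finset.sum_nonneg fun v _ => by split_ifs <;> simp
  have hmP := mul_nonneg (sub_nonneg.2 hm) (hnn P)
  have hB : 0 ≤ ∑ q ∈ S.resources i, σ.blocking i k q P s :=
    Finset.sum_nonneg fun q _ => blocking_nonneg i k q P s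
  by_cases hex : ∃ v ∈ P, σ.Executing ⟨i, (k, v)⟩ s
  · obtain ⟨v, hv, hex⟩ := hex
    have h₁ := hone Finset.univ v (Finset.mem_univ v) hex
    have h₂ := mul_le_mul_of_nonneg_left (hone P v hv hex) (sub_nonneg.2 hm)
    linarith
  by_cases hsp : ∃ q, ∃ v ∈ P, σ.Spinning ⟨i, (k, v)⟩ q s
  · obtain ⟨q, v, hv, hsp⟩ := hsp
    have h₁ := Finset.single_le_sum (f := fun q => σ.blocking i k q P s)
      (fun q _ => blocking_nonneg i k q P s) (h.mem_resources_of_spinning hsp)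
    have hval : σ.blocking i k q P s =
        if σ.HeldBy q i s then (S.m i : ℝ) - 1 else S.m i := by
      rw [blocking, if_pos ⟨v, hv, hsp⟩]
    simp only [hval] at h₁
    have h₂ := hnn Finset.univ
    split_ifs at h₁ with hheld
    · obtain ⟨w, hw⟩ : ∃ w, σ.holder q s = some ⟨i, (k, w)⟩ := by
        obtain ⟨⟨i', k', w⟩, hw, rfl⟩ := hheld
        obtain rfl : k' = k := h.job_eq hmet ht hs (h.holder_access q _ s hw).1 rfl
        exact ⟨w, hw⟩
      have h₃ := hone Finset.univ w (Finset.mem_univ w) (h.executing_of_holder hw)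
      linarith
    · linarith
  have hoff : ¬ ∃ v ∈ P, σ.OnProc ⟨i, (k, v)⟩ s := by
    rintro ⟨v, hv, hon⟩
    exact hex ⟨v, hv, hon, fun q hq => hsp ⟨q, v, hv, hq⟩⟩
  obtain ⟨w, hwP, hel, hnf⟩ := hkey
  have hbusy : ∀ p : Fin (S.m i), ∃ v, σ.sched i p s = some (k, v) := by
    intro p
    obtain ⟨⟨k', v⟩, hp⟩ := Option.ne_none_iff_exists'.1
      (h.work_conserving i k w s hel hnf (fun hon => hoff ⟨w, hwP, hon⟩) p)
    have : k' = k := h.job_eq hmet ht hs (x := ⟨i, (k', v)⟩) ⟨p, hp⟩ rfl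
    exact ⟨v, this ▸ hp⟩
  choose f hf using hbusy
  -- Work conservation keeps every processor busy with this job, so each one either executes or
  -- spins.
  have hcard : S.m i ≤ (Finset.univ.filter fun v => σ.OnProc ⟨i, (k, v)⟩ s).card := by
    have := Finset.card_le_card_of_injOn (s := Finset.univ)
      (t := Finset.univ.filter fun v => σ.OnProc ⟨i, (k, v)⟩ s) f
      (fun p _ => by simpa using ⟨p, hf p⟩)
      (fun p _ p' _ he => h.sched_injective i p p' (k, f p) s (hf p) (he ▸ hf p'))
    simpa using this
  have hcard' : (S.m i : ℝ) ≤ ∑ v, (if σ.OnProc ⟨i, (k, v)⟩ s then 1 else 0) := by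
    rw [Finset.sum_boole]; exact_mod_cast hcard
  have hblock : ∀ q, σ.blocking i k q P s =
      ∑ v, (if σ.Spinning ⟨i, (k, v)⟩ q s then 1 else 0) := by
    intro q
    rw [blocking, if_neg fun hq => hsp ⟨q, hq⟩, if_neg hoff, Finset.sum_boole]
  have hsplit : ∑ v, (if σ.OnProc ⟨i, (k, v)⟩ s then (1 : ℝ) else 0) ≤
      ∑ v, (if σ.Executing ⟨i, (k, v)⟩ s then 1 else 0) +
        ∑ q ∈ S.resources i, σ.blocking i k q P s := by
    simp only [hblock]
    rw [Finset.sum_comm, ← Finset.sum_add_distrib]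
    refine Finset.sum_le_sum fun v _ => ?_
    have hz : (0 : ℝ) ≤ ∑ q ∈ S.resources i, if σ.Spinning ⟨i, (k, v)⟩ q s then 1 else 0 :=
      Finset.sum_nonneg fun q _ => by split_ifs <;> simp
    by_cases hon : σ.OnProc ⟨i, (k, v)⟩ s
    · by_cases hsv : ∃ q, σ.Spinning ⟨i, (k, v)⟩ q s
      · obtain ⟨q, hq⟩ := hsv
        have h₁ := Finset.single_le_sum
          (f := fun q => if σ.Spinning ⟨i, (k, v)⟩ q s then (1 : ℝ) else 0)
          (fun q _ => by split_ifs <;> simp) (h.mem_resources_of_spinning hq)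
        simp only [if_pos hq] at h₁
        rw [if_pos hon]
        split_ifs <;> linarith
      · have hev : σ.Executing ⟨i, (k, v)⟩ s := ⟨hon, fun q hq => hsv ⟨q, hq⟩⟩
        rw [if_pos hon, if_pos hev]
        linarith
    · rw [if_neg hon]
      split_ifs <;> linarith
  linarith

/-! ### The response time bound and the absence of deadline misses. -/

/-- A job that is unfinished at a time `t` up to its deadline has been pending for less than the
response time bound, if all earlier deadlines are met. -/
theorem sub_lt_responseBound_of_not_jobFinished (hprio : σ.PriorityOrdered) {tie : TieBreak}
    (htie : σ.RespectsTies tie) {t : ℝ} (hmet : σ.MeetsDeadlinesBefore t) {i : ι} {k : ℕ}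
    (hrt : σ.release i k ≤ t) (ht : t ≤ σ.release i k + S.D i) (hnf : ¬ σ.JobFinished i k t) :
    t - σ.release i k < S.responseBound tie i := by
  classical
  have hm := one_le_m S i
  obtain ⟨v, hv⟩ : ∃ v, ¬ σ.Finished i k v t := by
    by_contra hall
    push Not at hall
    exact hnf ⟨hrt, hall⟩
  obtain ⟨u, hu⟩ : ∃ u, σ.work ⟨i, (k, u)⟩ t < Segment.total (σ.prog ⟨i, (k, u)⟩) := by
    by_contra hall
    push Not at hall
    exact hv ⟨hrt, fun u _ => hall u⟩
  obtain ⟨l, hl, hkey⟩ := h.exists_keyPath (k := k) v (Set.Ico (σ.release i k) t)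
    fun s hs => ⟨hs.1, fun hfin => hv (h.finished_mono hs.2.le hfin)⟩
  set π := (v :: l).reverse with hπdef
  have hπ : π.IsChain (S.E i) := List.isChain_reverse.2 hl
  set P := π.toFinset with hPdef
  have huniq : ∀ s, ∀ v ∈ P, ∀ w ∈ P, σ.OnProc ⟨i, (k, v)⟩ s → σ.OnProc ⟨i, (k, w)⟩ s →
      v = w := fun s v hv w hw =>
    h.eq_of_onProc_of_isChain hπ (List.mem_toFinset.1 hv) (List.mem_toFinset.1 hw)
  have hexec : ∀ v : S.V i, UpperIntegralLE (Set.Ico (σ.release i k) t)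
      (fun s => if σ.Executing ⟨i, (k, v)⟩ s then 1 else 0) (σ.work ⟨i, (k, v)⟩ t) := by
    intro v
    refine UpperIntegralLE.indicator (h.work_nonneg _ _) ?_
    have hfin : volume {s | s ∈ Set.Ico (σ.release i k) t ∧ σ.Executing ⟨i, (k, v)⟩ s} ≠ ⊤ :=
      ((measure_mono fun s hs => hs.1).trans_lt
        (b := volume (Set.Ico (σ.release i k) t)) (by simp)).ne
    rw [h.work_eq_add hrt, h.work_of_le_release le_rfl, zero_add, ofReal_measureReal hfin]
  have hbl := UpperIntegralLE.sum (S.resources i) fun q hq =>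
    h.upperIntegralLE_blocking hprio htie hmet ht huniq (q := q) (by simpa [resources] using hq)
  have htotal := ((UpperIntegralLE.sum Finset.univ fun v _ => hexec v).add
    (((UpperIntegralLE.sum P fun v _ => hexec v).const_mul (sub_nonneg.2 hm)).add
      hbl)).le_of_forall_le hrt fun s hs => h.m_le_executing_add_blocking hmet ht hs (by
        obtain ⟨w, hw, hw'⟩ := hkey s hs
        exact ⟨w, by rw [hPdef, List.mem_toFinset, hπdef, List.mem_reverse]; exact hw, hw'⟩)
  have hC : ∑ v, σ.work ⟨i, (k, v)⟩ t < S.totalWCET i :=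
    Finset.sum_lt_sum (fun v _ => (h.work_le_total _ t).trans (h.wcet i k v))
      ⟨u, Finset.mem_univ u, hu.trans_le (h.wcet i k u)⟩
  have hL : ∑ v ∈ P, σ.work ⟨i, (k, v)⟩ t ≤ S.longestPath i := by
    refine le_trans ?_ (sum_le_longestPath hπ)
    rw [← List.sum_toFinset _ (nodup_of_isChain hπ)]
    exact Finset.sum_le_sum fun v _ => (h.work_le_total _ t).trans (h.wcet i k v)
  have hL' := mul_le_mul_of_nonneg_left hL (sub_nonneg.2 hm)
  have hQ := Finset.sum_le_sum (s := S.resources i) fun q _ =>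
    Finset.le_sup' (s := Finset.range (S.N i q + 1))
      (fun x => S.intraTerm i q x + (S.lowerTerm i q x + S.higherTerm tie i q x))
      (Finset.mem_range.2 (Nat.lt_succ_of_le (h.card_jobRequests_le i k q P)))
  rw [responseBound, lt_div_iff₀ (by linarith)]
  linarith

omit [Fintype ι] [Fintype ρ] in
theorem jobFinished_of_wcrt_le {i : ι} (hi : σ.wcrt i ≤ ENNReal.ofReal (S.D i)) (k : ℕ) :
    σ.JobFinished i k (σ.release i k + S.D i) := by
  have hD := S.D_pos i
  by_contra hnf
  obtain ⟨u, hu⟩ : ∃ u, σ.work ⟨i, (k, u)⟩ (σ.release i k + S.D i) <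
      Segment.total (σ.prog ⟨i, (k, u)⟩) := by
    by_contra hall
    push Not at hall
    exact hnf ⟨by linarith, fun v => ⟨by linarith, fun u _ => hall u⟩⟩
  -- The response time is an infimum that might not be attained. The work `g` missing at the
  -- deadline takes at least `g` more time, so the infimum exceeds the deadline strictly.
  set g := Segment.total (σ.prog ⟨i, (k, u)⟩) - σ.work ⟨i, (k, u)⟩ (σ.release i k + S.D i)
    with hg
  have hlow : ENNReal.ofReal (S.D i + g) ≤ σ.responseTime i k := by
    refine le_iInf₂ fun t ht => ENNReal.ofReal_le_ofReal ?_
    have h₁ : Segment.total (σ.prog ⟨i, (k, u)⟩) ≤ σ.work ⟨i, (k, u)⟩ t := (ht.2 u).2 u .refl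
    rcases le_total (σ.release i k + S.D i) t with hle | hle
    · linarith [h.work_le_add (x := ⟨i, (k, u)⟩) hle]
    · linarith [h.work_mono ⟨i, (k, u)⟩ hle]
  have := (hlow.trans (le_iSup (σ.responseTime i) k)).trans hi
  rw [ENNReal.ofReal_le_ofReal_iff hD.le] at this
  linarith

/-- All jobs meet their deadlines. -/
theorem jobFinished_deadline (hprio : σ.PriorityOrdered) {tie : TieBreak}
    (htie : σ.RespectsTies tie)
    (hdeadline : ∀ k, σ.wcrt k ≤ ENNReal.ofReal (S.D k) ∨ S.responseBound tie k ≤ S.D k)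
    (i : ι) (k : ℕ) : σ.JobFinished i k (σ.release i k + S.D i) := by
  classical
  by_contra hbad
  set B := Finset.univ.filter fun j => ∃ k, ¬ σ.JobFinished j k (σ.release j k + S.D j) with hB
  have hex : ∀ j ∈ B, ∃ k, ¬ σ.JobFinished j k (σ.release j k + S.D j) ∧
      ∀ k', ¬ σ.JobFinished j k' (σ.release j k' + S.D j) → k ≤ k' := by
    intro j hj
    have hj' := (Finset.mem_filter.1 hj).2
    exact ⟨Nat.find hj', Nat.find_spec hj', fun k' => Nat.find_min' hj'⟩
  choose! κ hκ hκmin using hex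
  -- The earliest missed deadline exists: each task has a first miss, and there are finitely many
  -- tasks.
  obtain ⟨j, hj, hjmin⟩ := Finset.exists_min_image B (fun j => σ.release j (κ j) + S.D j)
    ⟨i, Finset.mem_filter.2 ⟨Finset.mem_univ i, k, hbad⟩⟩
  have hmet : σ.MeetsDeadlinesBefore (σ.release j (κ j) + S.D j) := by
    intro j' k' hlt
    by_contra hb
    have hj' : j' ∈ B := Finset.mem_filter.2 ⟨Finset.mem_univ j', k', hb⟩
    linarith [hjmin j' hj', h.release_mono j' (hκmin j' hj' k' hb)]
  rcases hdeadline j with hd | hd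
  · exact hκ j hj (h.jobFinished_of_wcrt_le hd _)
  · have := h.sub_lt_responseBound_of_not_jobFinished hprio htie hmet
      (by linarith [S.D_pos j]) le_rfl (hκ j hj)
    linarith

end IsLegal

end Run

end TaskSystem

theorem mainTheorem4 {ι ρ : Type*} [Fintype ι] [Fintype ρ] (S : TaskSystem ι ρ) (tie : TieBreak)
    (σ : S.Run) (hlegal : σ.IsLegal) (hprio : σ.PriorityOrdered) (htie : σ.RespectsTies tie)
    (hdeadline : ∀ k, σ.wcrt k ≤ ENNReal.ofReal (S.D k) ∨ S.responseBound tie k ≤ S.D k)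
    (i : ι) :
    σ.wcrt i ≤ ENNReal.ofReal (S.responseBound tie i) := by
  have hfin := hlegal.jobFinished_deadline hprio htie hdeadline
  refine iSup_le fun k => ?_
  -- The bound on pending time applies only up to the deadline. If $R_i'\ge D_i$, meeting the
  -- deadline suffices; otherwise the job is tested at $\max(R_i',0)$ after its release, the maximum
  -- avoiding a proof that $R_i'\ge 0$.
  rcases le_total (S.D i) (S.responseBound tie i) with hle | hle
  · refine (iInf₂_le _ (hfin i k)).trans (ENNReal.ofReal_le_ofReal ?_)
    linarith
  · have hmax : max (S.responseBound tie i) 0 ≤ S.D i := max_le hle (S.D_pos i).le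
    have hdone : σ.JobFinished i k (σ.release i k + max (S.responseBound tie i) 0) := by
      by_contra hnf
      have := hlegal.sub_lt_responseBound_of_not_jobFinished hprio htie (fun j k' _ => hfin j k')
        (by linarith [le_max_right (S.responseBound tie i) 0]) (by linarith) hnf
      linarith [le_max_left (S.responseBound tie i) 0]
    refine (iInf₂_le _ hdone).trans ?_
    rw [add_sub_cancel_left]
    rcases le_total (S.responseBound tie i) 0 with h₀ | h₀
    · rw [max_eq_right h₀]; simp
    · rw [max_eq_left h₀]
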